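/- **Setting.** Let $\mathbb N=\{1,2,\dots\}$. We use the synchronous deterministic LOCAL model: in each round every node that has not terminated sends messages of unrestricted size to its neighbors (reached through arbitrarily numbered ports), receives their messages and performs an arbitrary local computation; a node terminates by fixing its output. The running time is the number of rounds until all nodes have terminated. Initially a node knows its degree, its identity and its initial color. Let $\mathcal G$ be a family of finite simple graphs whose nodes carry identities, closed under taking (not necessarily induced) subgraphs. An *instance* is a pair $(G,c)$ with $G\in\mathcal G$ and $c:V(G)\to\mathbb N$ a proper coloring (the initial colors, which may be unique identities). A *parameter* assigns a positive integer to each instance; it is *non-decreasing* if it does not increase when passing to a sub-instance. $\Delta$ is the maximum degree ($1$ if $G$ has no edge) and $m$ is the largest initial color ($1$ if $G$ is empty). Let $\Gamma\subseteq\{\Delta,m\}$, and let $\Lambda$ be a finite set of non-decreasing parameters, each of which is $m$ or depends only on the graph and its identities. Write $\Lambda^*$ for the vector of the values of the parameters in $\Lambda$ at the instance at hand. An algorithm $A^\Gamma$ is given one value $\tilde p\in\mathbb N$ (a *guess*) for each $p\in\Gamma$, the same at all nodes; the guesses are *good* for an instance if $\tilde p\ge p(G,c)$ for all $p\in\Gamma$.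 For $p\notin\Gamma$ write $\tilde p=p(G,c)$. $A^\Gamma$ is a *$g(\tilde\Delta)$-coloring algorithm with running time bounded by $f:\mathbb N^{\Lambda}\to(0,\infty)$* ($f$ non-decreasing) if on every instance, with any port numbering and any good guesses, it terminates within $f((\tilde q)_{q\in\Lambda})$ rounds and outputs a proper coloring with colors in $\{k\in\mathbb N: k\le g(\tilde\Delta)\}$. A *uniform* algorithm receives no guesses. *Definitions.* $\Gamma$ is *weakly dominated* by $\Lambda$ if for each $p\in\Gamma\setminus\Lambda$ there are $q\in\Lambda$ and a non-decreasing $h$ on $(0,\infty)$ tending to infinity with $h(p(G,c))\le q(G,c)$ for all instances. A non-decreasing $u$ is *moderately slow* if for some $\alpha\in\mathbb N$, $u(2i)\le\alpha u(i)$ for all $i\in\mathbb N\setminus\{1\}$. A function $g$ on $(0,\infty)$ is *moderately fast* if it is non-decreasing, for some $\alpha\in\mathbb N$ one has $g(\alpha i)\ge 2g(i)$ and $g(2i)\le\alpha g(i)$ for all $i\in\mathbb N\setminus\{1\}$, and for some polynomial $P$, $x<g(x)<P(x)$ for all $x>0$. A *sequence-number function* for $f$ is a moderately slow function $s_f$ on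 $\mathbb N$ with non-negative integer values for which there are finite sets $S(i)\subset\mathbb N^\Lambda$ ($i\in\mathbb N$) and $c_0>0$ such that for all $i$: every $y$ with $f(y)\le i$ is coordinatewise at most some $x\in S(i)$; $f(x)\le c_0 i$ for all $x\in S(i)$; and $|S(i)|\le s_f(i)$. **Theorem.** Let $\Gamma$ be weakly dominated by $\Lambda$ and let $A^\Gamma$ be a $g(\tilde\Delta)$-coloring algorithm with running time bounded by $f$. Assume that 1. $s_f$ is a sequence-number function for $f$; 2. $g$ is moderately fast; 3. if $m\in\Lambda$, then $f$ depends polylogarithmically on $m$: there are $k\in\mathbb N\cup\{0\}$ and $C$ such that, for all fixed values of the other variables and all integers $2\le M\le M'$, $f(\dots,M',\dots)\le C\left(\frac{\log M'}{\log M}\right)^{k} f(\dots,M,\dots)$; 4. if $\Delta\in\Lambda$, then $f$ is moderately slow as a function of $\Delta$, with a constant $\alpha$ that does not depend on the other variables. Then there are a uniform deterministic algorithm and a constant $C$ such that, on every instance (with any port numbering), the algorithm terminates within $C\cdot f(\Lambda^*)\cdot s_f(\lceil f(\Lambda^*)\rceil)$ rounds and outputs a proper coloring with colors in $\{k\in\mathbb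 N: k\le C\cdot g(\Delta)\}$. -/

import Mathlib

/-! ### Networks, instances and parameters -/

/-- A finite simple graph whose nodes carry identities.  Nodes are named by natural numbers; a node
has access to its identity only, never to its name.  The identities are not forced to be distinct
here: a family of networks may impose this. -/
structure Network where
  verts : Finset ℕ
  graph : SimpleGraph ℕ
  mem_of_adj : ∀ u v, graph.Adj u v → u ∈ verts
  ident : ℕ → ℕ

/-- `N'` is a subgraph of `N` (not necessarily induced), with the restricted identities. -/
def Network.IsSub (N' N : Network) : Prop :=
  N'.verts ⊆ N.verts ∧ N'.graph ≤ N.graph ∧ ∀ v ∈ N'.verts, N'.ident v = N.ident v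

/-- An instance of the coloring problem: a network together with initial colors, which are
positive integers and form a (proper) coloring. -/
structure Instance extends Network where
  color : ℕ → ℕ
  color_pos : ∀ v ∈ verts, 0 < color v
  color_proper : ∀ u v, graph.Adj u v → color u ≠ color v

/-- `I'` is a sub-instance of `I`: a subgraph, with the inputs restricted to it. -/
def Instance.IsSub (I' I : Instance) : Prop :=
  I'.toNetwork.IsSub I.toNetwork ∧ ∀ v ∈ I'.verts, I'.color v = I.color v

/-- Families of networks that are closed under inclusion. -/
def ClosedUnderInclusion (𝒢 : Set Network) : Prop :=
  ∀ N ∈ 𝒢, ∀ N' : Network, N'.IsSub N → N' ∈ 𝒢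

/-- A parameter: a positive integer attached to each instance. -/
abbrev Parameter : Type := Instance → ℕ+

/-- `p` is non-decreasing on the instances over the family `𝒢`. -/
def NonDecreasing (𝒢 : Set Network) (p : Parameter) : Prop :=
  ∀ I I' : Instance, I.toNetwork ∈ 𝒢 → I'.IsSub I → p I' ≤ p I

/-- `p` depends on the graph and on the identities only. -/
def IsGraphParameter (𝒢 : Set Network) (p : Parameter) : Prop :=
  ∀ I I' : Instance, I.toNetwork ∈ 𝒢 → I.toNetwork = I'.toNetwork → p I = p I'

open Classical in
/-- The degree of a node. -/
noncomputable def Network.degree (N : Network) (v : ℕ) : ℕ :=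
  (N.verts.filter (fun u => N.graph.Adj v u)).card

/-- The parameter `Δ`: the maximum degree (and `1` if there is no edge, parameters being
positive). -/
noncomputable def maxDegree : Parameter := fun I =>
  ⟨max 1 (I.verts.sup I.degree), lt_of_lt_of_le one_pos (le_max_left _ _)⟩

/-- The parameter `m`: the largest initial color (and `1` for the empty graph). -/
def maxColor : Parameter := fun I =>
  ⟨max 1 (I.verts.sup I.color), lt_of_lt_of_le one_pos (le_max_left _ _)⟩

/-! ### Deterministic algorithms in the LOCAL model -/

/-- For each node, an enumeration `ports v` of its neighbors: the `i`-th entry is the neighbor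
reached through port `i` of `v`. -/
def IsPortNumbering (N : Network) (ports : ℕ → List ℕ) : Prop :=
  ∀ v ∈ N.verts, (ports v).Nodup ∧ ∀ u, u ∈ ports v ↔ N.graph.Adj v u

/-- A deterministic local algorithm, all of whose nodes are given the same value of type `G`
(the guesses; `G = Unit` for a uniform algorithm).  Local computations are arbitrary functions and
messages have unrestricted size. -/
structure LocalAlgorithm (G : Type) where
  State : Type
  Msg : Type
  /-- initial state, from the guesses, the degree, the identity and the initial color -/
  init : G → (degree : ℕ) → (ident : ℕ) → (color : ℕ) → State
  /-- the message sent through a given port -/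
  send : State → (port : ℕ) → Msg
  /-- the new state, from the messages received through ports `0, 1, 2, …`
  (`none` through a port that leads to a terminated neighbor) -/
  step : State → List (Option Msg) → State
  /-- `some y` once the node has terminated with final output `y` -/
  out : State → Option ℕ

open Classical in
/-- The state of each node after `t` synchronous rounds.  A node that has terminated keeps its state
and sends no messages. -/
noncomputable def LocalAlgorithm.run {G : Type} (A : LocalAlgorithm G) (a : G) (I : Instance)
    (ports : ℕ → List ℕ) : ℕ → ℕ → A.State
  | 0 => fun v => A.init a (ports v).length (I.ident v) (I.color v)
  | t + 1 => fun v =>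
      if (A.out (A.run a I ports t v)).isSome then A.run a I ports t v
      else A.step (A.run a I ports t v)
        ((ports v).map fun u =>
          if (A.out (A.run a I ports t u)).isSome then none
          else some (A.send (A.run a I ports t u) ((ports u).idxOf v)))

/-- Within `T` rounds all nodes have terminated, and the outputs form a coloring with colors among
the integers in `[1, K]`. -/
def LocalAlgorithm.ColorsWithin {G : Type} (A : LocalAlgorithm G) (a : G) (I : Instance)
    (ports : ℕ → List ℕ) (K T : ℝ) : Prop :=
  ∃ t : ℕ, (t : ℝ) ≤ T ∧ ∃ y : ℕ → ℕ,
    (∀ v ∈ I.verts, A.out (A.run a I ports t v) = some (y v)) ∧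
    (∀ v ∈ I.verts, 1 ≤ y v ∧ (y v : ℝ) ≤ K) ∧
    (∀ u v, I.graph.Adj u v → y u ≠ y v)

/-! ### Guesses -/

/-- A collection of guesses for the parameters in `Γ`. -/
abbrev Guesses (Γ : Finset Parameter) : Type := Γ → ℕ+

/-- All guesses are good: at least the true value. -/
def Good {Γ : Finset Parameter} (a : Guesses Γ) (I : Instance) : Prop :=
  ∀ p : Γ, p.1 I ≤ a p

open Classical in
/-- The guess for `p` if `p` belongs to `Γ`, the true value of `p` otherwise. -/
noncomputable def guessOrTrue {Γ : Finset Parameter} (a : Guesses Γ) (I : Instance)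
    (p : Parameter) : ℕ+ :=
  if h : p ∈ Γ then a ⟨p, h⟩ else p I

/-- `A` is a `g(Δ̃)`-coloring algorithm for the instances over `𝒢`, depending on `Γ`, with running
time bounded with respect to `Λ` by `f`: this is required for good guesses only. -/
def IsColoringAlgorithm (𝒢 : Set Network) (Γ Λ : Finset Parameter)
    (A : LocalAlgorithm (Guesses Γ)) (g : ℝ → ℝ) (f : (Λ → ℕ+) → ℝ) : Prop :=
  ∀ I : Instance, I.toNetwork ∈ 𝒢 →
    ∀ ports : ℕ → List ℕ, IsPortNumbering I.toNetwork ports →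
      ∀ a : Guesses Γ, Good a I →
        A.ColorsWithin a I ports (g (guessOrTrue a I maxDegree : ℕ))
          (f fun q => guessOrTrue a I q.1)

/-! ### Growth conditions -/

/-- Non-decreasing on the positive reals and tending to infinity. -/
def Ascending (h : ℝ → ℝ) : Prop :=
  MonotoneOn h (Set.Ioi 0) ∧ Filter.Tendsto h Filter.atTop Filter.atTop

/-- `Γ` is weakly dominated by `Λ`. -/
def WeaklyDominated (𝒢 : Set Network) (Γ Λ : Finset Parameter) : Prop :=
  ∀ p ∈ Γ, p ∉ Λ → ∃ q ∈ Λ, ∃ h : ℝ → ℝ, Ascending h ∧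
    ∀ I : Instance, I.toNetwork ∈ 𝒢 → h (p I : ℕ) ≤ (q I : ℕ)

/-- `u` is moderately slow, with constant `α`. -/
def ModeratelySlowWith (α : ℕ+) (u : ℕ+ → ℝ) : Prop :=
  Monotone u ∧ ∀ i : ℕ+, i ≠ 1 → u (2 * i) ≤ (α : ℕ) * u i

/-- `u` is moderately slow. -/
def ModeratelySlow (u : ℕ+ → ℝ) : Prop :=
  ∃ α : ℕ+, ModeratelySlowWith α u

/-- `g` is moderately increasing (as a function on the positive reals). -/
def ModeratelyIncreasing (g : ℝ → ℝ) : Prop :=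
  MonotoneOn g (Set.Ioi 0) ∧ ∃ α : ℕ+, ∀ i : ℕ+, i ≠ 1 →
    2 * g (i : ℕ) ≤ g ((α * i : ℕ+) : ℕ) ∧ g ((2 * i : ℕ+) : ℕ) ≤ (α : ℕ) * g (i : ℕ)

/-- `g` is moderately fast (as a function on the positive reals). -/
def ModeratelyFast (g : ℝ → ℝ) : Prop :=
  ModeratelyIncreasing g ∧ ∃ P : Polynomial ℝ, ∀ x : ℝ, 0 < x → x < g x ∧ g x < P.eval x

/-- `s` is a sequence-number function for `f`: it is moderately slow and it bounds the
cardinalities of some bounded set-sequence `S` for `f`. -/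
def IsSequenceNumberFunction {ι : Type} (f : (ι → ℕ+) → ℝ) (s : ℕ+ → ℕ) : Prop :=
  ModeratelySlow (fun i => (s i : ℝ)) ∧
    ∃ (S : ℕ+ → Finset (ι → ℕ+)) (c : ℝ), 0 < c ∧ ∀ i : ℕ+,
      (∀ y : ι → ℕ+, f y ≤ (i : ℕ) → ∃ x ∈ S i, y ≤ x) ∧
      (∀ x ∈ S i, f x ≤ c * (i : ℕ)) ∧
      (S i).card ≤ s i

open Classical in
/-- `f` depends moderately slowly on its variable `j`, with a constant that does not depend on the
other variables. -/
def DependsModeratelySlowly {ι : Type} (f : (ι → ℕ+) → ℝ) (j : ι) : Prop :=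
  ∃ α : ℕ+, ∀ x : ι → ℕ+, ModeratelySlowWith α (fun i => f (Function.update x j i))

open Classical in
/-- `f` depends polylogarithmically on its variable `j`: when the variable grows from `M` to `M'`,
`f` grows at most by a factor polynomial in `log M' / log M`, uniformly in the other variables. -/
def DependsPolylogarithmically {ι : Type} (f : (ι → ℕ+) → ℝ) (j : ι) : Prop :=
  ∃ (k : ℕ) (C : ℝ), ∀ (x : ι → ℕ+) (M M' : ℕ+), 2 ≤ M → M ≤ M' →
    f (Function.update x j M') ≤
      C * (Real.log (M' : ℕ) / Real.log (M : ℕ)) ^ k * f (Function.update x j M)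

/-!
# A uniform coloring algorithm from an algorithm that needs guesses

The nodes are divided into layers: the layer `k` consists of the nodes of degree at most `2 ^ k`
and, if `k ≥ 1`, more than `2 ^ (k - 1)`.  The layers are treated in parallel, with disjoint sets of
output colors, of sizes `2 * palette k` where `palette k = ⌊g (2 ^ k)⌋`.  As `g` is moderately fast,
these sizes grow geometrically, and their sum over the layers that occur is `O(g Δ)`
(`palette_sum_le`).  Within the layer `k`, the number `2 ^ k` is a good guess for `Δ`, and it exceeds
the true maximum degree at most by a factor `2`, so that its use costs a constant factor only
(`raise_maxDegree_le`).

A node whose initial color is at most `palette k` simply keeps this color.  The others, the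
contenders of the layer, are colored in two phases.

*Trials.*  The guess vectors in the sets `S 1, S 2, S 4, …` of the bounded set-sequence of `f` are
tried one after the other, those of `S i` for about `c * i` rounds each (`exists_schedule`).  In a
trial, `A` is simulated on the contenders without a provisional color.  A node whose tentative
color lies in the palette and differs from the tentative colors of its neighbors fixes a provisional
color: the pair of the tentative color and a number, at most its degree, that distinguishes it from
the pairs fixed in earlier trials (`pairs_proper`).  A trial with good guesses and enough time fixes
all the pairs (`pair_isSome_of_colorsWithin`), and it comes within `O(f(Λ*) s(f(Λ*)))` rounds.

*Reduction.*  The pairs are a proper coloring with at most `(palette k + 1) ^ 2` colors, as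
`2 ^ k ≤ g (2 ^ k)`.  So `A` can be simulated once more, on all contenders, with the pairs as initial
colors and with guesses that are now known to be good (`nodeOut_of_colorsWithin`).  Each contender
has an initial color larger than `palette k`, hence `log ((palette k + 1) ^ 2) ≤ 2 * log m`, and the
running time is `O(f(Λ*))` because `f` depends polylogarithmically on `m` (`raise_maxColor_le`).
Nodes cannot detect the end of the trials elsewhere.  Therefore this execution is simulated
asynchronously: a node performs a simulated round as soon as its neighbors have performed the
previous one, which never delays it beyond the global end of the trials (`knows_of_pairs`).

The machine that does all this is described in a model in which nodes see the whole states of their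
neighbors, even of those that have terminated; such a machine runs in the LOCAL model with one
additional round (`BroadcastMachine.toLocal`).
-/

/-! ### Machines whose nodes see the whole states of their neighbors -/

/-- A synchronous algorithm in which every node sees the whole current state of each neighbor,
together with the number of the port through which that neighbor sees it.  A node that has
produced an output keeps its state, and this state remains visible to its neighbors. -/
structure BroadcastMachine where
  State : Type
  init : (degree : ℕ) → (ident : ℕ) → (color : ℕ) → State
  step : State → List (State × ℕ) → State
  out : State → Option ℕ
  step_of_out : ∀ s l, (out s).isSome → step s l = s

/-- The state of each node after `t` rounds. -/
def BroadcastMachine.run (M : BroadcastMachine) (I : Instance) (ports : ℕ → List ℕ) :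
    ℕ → ℕ → M.State
  | 0 => fun v => M.init (ports v).length (I.ident v) (I.color v)
  | t + 1 => fun v => M.step (M.run I ports t v)
      ((ports v).map fun u => (M.run I ports t u, (ports u).idxOf v))

/-- The implementation of a broadcast machine in the LOCAL model.  A node stores, besides its
machine state, the last message received through each port, and it terminates one round after the
machine has produced an output: its neighbors have then received, and keep, its final state. -/
def BroadcastMachine.toLocal (M : BroadcastMachine) : LocalAlgorithm Unit where
  State := M.State × List (M.State × ℕ) × Bool
  Msg := M.State × ℕ
  init _ d i c := (M.init d i c, List.replicate d (M.init d i c, 0), false)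
  send s p := (s.1, p)
  step s l :=
    let l' := List.zipWith (fun new old => new.getD old) l s.2.1
    (M.step s.1 l', l', (M.out s.1).isSome)
  out s := if s.2.2 then M.out s.1 else none

theorem LocalAlgorithm.run_succ {G : Type} (A : LocalAlgorithm G) (a : G) (I : Instance)
    (ports : ℕ → List ℕ) (t v : ℕ) : A.run a I ports (t + 1) v =
      if (A.out (A.run a I ports t v)).isSome then A.run a I ports t v
      else A.step (A.run a I ports t v)
        ((ports v).map fun u =>
          if (A.out (A.run a I ports t u)).isSome then none
          else some (A.send (A.run a I ports t u) ((ports u).idxOf v))) := rfl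

theorem LocalAlgorithm.run_of_out {G : Type} (A : LocalAlgorithm G) (a : G) (I : Instance)
    (ports : ℕ → List ℕ) {t v : ℕ} (h : (A.out (A.run a I ports t v)).isSome) {t' : ℕ}
    (ht : t ≤ t') : A.run a I ports t' v = A.run a I ports t v := by
  induction t', ht using Nat.le_induction with
  | base => rfl
  | succ n _ ih => rw [LocalAlgorithm.run_succ, ih, if_pos h]

namespace BroadcastMachine

variable (M : BroadcastMachine) (I : Instance) (ports : ℕ → List ℕ)

theorem run_succ (t v : ℕ) : M.run I ports (t + 1) v = M.step (M.run I ports t v)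
      ((ports v).map fun u => (M.run I ports t u, (ports u).idxOf v)) := rfl

theorem toLocal_out_eq_none {x : M.toLocal.State} (h : ¬ x.2.2 = true) :
    M.toLocal.out x = none := if_neg h

theorem toLocal_out_eq {x : M.toLocal.State} (h : x.2.2 = true) :
    M.toLocal.out x = M.out x.1 := if_pos h

/-- The memory of a node that is still running agrees with the final states of its terminated
neighbors, so that the machine state is simulated faithfully. -/
theorem toLocal_run (t : ℕ) (v : ℕ) :
    (M.toLocal.run () I ports t v).1 = M.run I ports t v ∧
    ((M.toLocal.run () I ports t v).2.2 = true → (M.out (M.run I ports t v)).isSome) ∧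
    ((M.toLocal.run () I ports t v).2.2 = false → ∃ h : ℕ → M.State × ℕ,
      (M.toLocal.run () I ports t v).2.1 = (ports v).map h ∧
      ∀ u, (M.toLocal.run () I ports t u).2.2 = true →
        h u = (M.run I ports t u, (ports u).idxOf v)) := by
  induction t generalizing v with
  | zero =>
    refine ⟨rfl, fun h => by simp [LocalAlgorithm.run, toLocal] at h, fun _ =>
      ⟨fun _ => (M.init (ports v).length (I.ident v) (I.color v), 0), ?_, fun u h => by
        simp [LocalAlgorithm.run, toLocal] at h⟩⟩
    simp [LocalAlgorithm.run, toLocal]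
  | succ t ih =>
    have halt : ∀ u, (M.toLocal.out (M.toLocal.run () I ports t u)).isSome = true ↔
        (M.toLocal.run () I ports t u).2.2 = true := by
      intro u
      have := (ih u).2.1
      rw [← (ih u).1] at this
      constructor
      · intro h
        by_contra h'
        rw [M.toLocal_out_eq_none h'] at h
        simp at h
      · intro h
        rw [M.toLocal_out_eq h]
        exact this h
    have stay : ∀ u, (M.out (M.run I ports t u)).isSome →
        M.run I ports (t + 1) u = M.run I ports t u := fun u h => M.step_of_out _ _ h
    -- the value of the flag after the step, and what it says about the machine
    have flag : ∀ u, (M.toLocal.run () I ports (t + 1) u).2.2 = true →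
        (M.out (M.run I ports t u)).isSome := by
      intro u h
      by_cases hu : (M.toLocal.run () I ports t u).2.2 = true
      · exact (ih u).2.1 hu
      · have : M.toLocal.run () I ports (t + 1) u = M.toLocal.step (M.toLocal.run () I ports t u)
          ((ports u).map fun w =>
            if (M.toLocal.out (M.toLocal.run () I ports t w)).isSome then none
            else some (M.toLocal.send (M.toLocal.run () I ports t w) ((ports w).idxOf u))) := by
          rw [LocalAlgorithm.run_succ, if_neg (by rwa [halt])]
        rw [this] at h
        rw [← (ih u).1]
        exact h
    by_cases hv : (M.toLocal.run () I ports t v).2.2 = true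
    · have e : M.toLocal.run () I ports (t + 1) v = M.toLocal.run () I ports t v := by
        rw [LocalAlgorithm.run_succ, if_pos (by rwa [halt])]
      have hs := (ih v).2.1 hv
      rw [e, stay v hs]
      exact ⟨(ih v).1, fun _ => hs, fun h => by simp [hv] at h⟩
    · have e : M.toLocal.run () I ports (t + 1) v = M.toLocal.step (M.toLocal.run () I ports t v)
          ((ports v).map fun w =>
            if (M.toLocal.out (M.toLocal.run () I ports t w)).isSome then none
            else some (M.toLocal.send (M.toLocal.run () I ports t w) ((ports w).idxOf v))) := by
        rw [LocalAlgorithm.run_succ, if_neg (by rwa [halt])]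
      obtain ⟨h, hmem, hh⟩ := (ih v).2.2 (by simpa using hv)
      have inp : List.zipWith (fun new old => Option.getD new old)
          ((ports v).map fun w =>
            if (M.toLocal.out (M.toLocal.run () I ports t w)).isSome then none
            else some (M.toLocal.send (M.toLocal.run () I ports t w) ((ports w).idxOf v)))
          ((M.toLocal.run () I ports t v).2.1 : List (M.State × ℕ)) =
          (ports v).map fun u => (M.run I ports t u, (ports u).idxOf v) := by
        rw [hmem]
        refine (List.zipWith_map ..).trans ((List.zipWith_self ..).trans ?_)
        refine List.map_congr_left fun u _ => ?_
        by_cases hu : (M.toLocal.run () I ports t u).2.2 = true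
        · rw [if_pos (by rwa [halt])]
          exact hh u hu
        · rw [if_neg (by rwa [halt]), ← (ih u).1]
          rfl
      refine ⟨?_, fun h' => ?_, fun _ =>
        ⟨fun u => (M.run I ports t u, (ports u).idxOf v), ?_, fun u hu => ?_⟩⟩
      · rw [e]
        change M.step _ _ = M.step _ _
        rw [← (ih v).1]
        exact congrArg _ inp
      · have := flag v h'
        rwa [stay v this]
      · rw [e]
        exact inp
      · rw [stay u (flag u hu)]

theorem run_of_out {t : ℕ} {v : ℕ} (h : (M.out (M.run I ports t v)).isSome) {t' : ℕ}
    (ht : t ≤ t') : M.run I ports t' v = M.run I ports t v := by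
  induction t', ht using Nat.le_induction with
  | base => rfl
  | succ n _ ih => rw [run_succ, ih]; exact M.step_of_out _ _ h

theorem toLocal_out {t v y : ℕ} (h : M.out (M.run I ports t v) = some y) :
    M.toLocal.out (M.toLocal.run () I ports (t + 1) v) = some y := by
  have h1 := (M.toLocal_run I ports (t + 1) v).1
  rw [M.run_of_out I ports (by simp [h]) (Nat.le_succ t)] at h1
  have h2 : (M.toLocal.run () I ports (t + 1) v).2.2 = true := by
    by_cases hv : (M.toLocal.out (M.toLocal.run () I ports t v)).isSome
    · have e : M.toLocal.run () I ports (t + 1) v = M.toLocal.run () I ports t v := by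
        rw [LocalAlgorithm.run_succ, if_pos hv]
      rw [e]
      by_contra h'
      rw [M.toLocal_out_eq_none h'] at hv
      simp at hv
    · have e : (M.toLocal.run () I ports (t + 1) v).2.2 =
          (M.out (M.toLocal.run () I ports t v).1).isSome := by
        rw [LocalAlgorithm.run_succ, if_neg hv]
        rfl
      rw [e, (M.toLocal_run I ports t v).1]
      simp [h]
  change (if _ then _ else _) = _
  rw [if_pos h2, h1, h]

end BroadcastMachine

/-! ### Local algorithms on induced sub-instances -/

/-- The sub-instance induced by the nodes in `W`, with new initial colors `χ`. -/
def Instance.induce (I : Instance) (W : Finset ℕ) (χ : ℕ → ℕ)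
    (hpos : ∀ v ∈ W, 0 < χ v)
    (hproper : ∀ u ∈ W, ∀ v ∈ W, I.graph.Adj u v → χ u ≠ χ v) : Instance where
  verts := I.verts ∩ W
  graph :=
    { Adj := fun u v => I.graph.Adj u v ∧ u ∈ W ∧ v ∈ W
      symm := ⟨fun _ _ h => ⟨h.1.symm, h.2.2, h.2.1⟩⟩
      loopless := ⟨fun _ h => h.1.ne rfl⟩ }
  mem_of_adj u v h := Finset.mem_inter.2 ⟨I.mem_of_adj u v h.1, h.2.1⟩
  ident := I.ident
  color := χ
  color_pos v hv := hpos v (Finset.mem_inter.1 hv).2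
  color_proper u v h := hproper u h.2.1 v h.2.2 h.1

/-- The ports that lead to nodes in `W`, in the same order. -/
def portsIn (ports : ℕ → List ℕ) (W : Finset ℕ) (v : ℕ) : List ℕ :=
  (ports v).filter (fun u => decide (u ∈ W))

theorem isPortNumbering_portsIn {I : Instance} {ports : ℕ → List ℕ}
    (h : IsPortNumbering I.toNetwork ports) (W : Finset ℕ) (χ : ℕ → ℕ) (hpos) (hproper) :
    IsPortNumbering (I.induce W χ hpos hproper).toNetwork (portsIn ports W) := by
  intro v hv
  obtain ⟨h1, h2⟩ := Finset.mem_inter.1 hv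
  refine ⟨(h v h1).1.filter _, fun u => ?_⟩
  simp only [portsIn, List.mem_filter, decide_eq_true_eq, (h v h1).2, Instance.induce]
  tauto

theorem Instance.induce_isSub (I : Instance) (W : Finset ℕ) (χ : ℕ → ℕ) (hpos) (hproper) :
    (I.induce W χ hpos hproper).toNetwork.IsSub I.toNetwork :=
  ⟨Finset.inter_subset_left, fun _ _ h => h.1, fun _ _ => rfl⟩

theorem length_ports {N : Network} {ports : ℕ → List ℕ} (h : IsPortNumbering N ports) {v : ℕ}
    (hv : v ∈ N.verts) : (ports v).length = N.degree v := by
  classical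
  rw [← List.toFinset_card_of_nodup (h v hv).1, Network.degree]
  congr 1
  ext u
  simp only [List.mem_toFinset, (h v hv).2, Finset.mem_filter]
  exact ⟨fun e => ⟨N.mem_of_adj _ _ e.symm, e⟩, fun e => e.2⟩

theorem degree_le_maxDegree (I : Instance) {v : ℕ} (hv : v ∈ I.verts) :
    I.degree v ≤ (maxDegree I : ℕ) :=
  le_trans (Finset.le_sup (f := I.degree) hv) (le_max_right _ _)

theorem color_le_maxColor (I : Instance) {v : ℕ} (hv : v ∈ I.verts) :
    I.color v ≤ (maxColor I : ℕ) :=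
  le_trans (Finset.le_sup (f := I.color) hv) (le_max_right _ _)

theorem maxColor_le {I : Instance} {M : ℕ+} (h : ∀ v ∈ I.verts, I.color v ≤ (M : ℕ)) :
    maxColor I ≤ M :=
  PNat.coe_le_coe _ _ |>.1 (max_le (Nat.succ_le_of_lt (PNat.pos _)) (Finset.sup_le h))

theorem maxDegree_induce_le {I : Instance} {W : Finset ℕ} {χ : ℕ → ℕ} {hpos} {hproper} {D : ℕ+}
    (h : ∀ v ∈ W, v ∈ I.verts → I.degree v ≤ (D : ℕ)) :
    maxDegree (I.induce W χ hpos hproper) ≤ D := by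
  classical
  refine PNat.coe_le_coe _ _ |>.1 (max_le (Nat.succ_le_of_lt (PNat.pos _))
    (Finset.sup_le fun v hv => ?_))
  obtain ⟨h1, h2⟩ := Finset.mem_inter.1 hv
  refine le_trans (Finset.card_le_card fun u hu => ?_) (h v h2 h1)
  obtain ⟨hu1, hu2⟩ := Finset.mem_filter.1 hu
  exact Finset.mem_filter.2 ⟨(Finset.mem_inter.1 hu1).1, hu2.1⟩

/-- The position of an entry in a filtered list is the number of selected entries before it. -/
theorem idxOf_filter {p : ℕ → Bool} {v : ℕ} (hv : p v = true) (l : List ℕ) :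
    (l.filter p).idxOf v = ((l.map p).take (l.idxOf v)).count true := by
  induction l with
  | nil => simp
  | cons a l ih =>
    by_cases ha : a = v
    · subst ha
      simp [hv]
    · by_cases hp : p a = true
      · rw [List.filter_cons_of_pos hp, List.idxOf_cons_ne _ ha, List.idxOf_cons_ne _ ha, ih]
        simp [hp]
      · rw [List.filter_cons_of_neg hp, List.idxOf_cons_ne _ ha, ih]
        simp [hp]

/-! ### The uniform coloring machine -/

/-- The data from which the uniform algorithm is built: the size `palette k` of the palette of the
`k`-th degree layer; the guesses used in that layer in the `n`-th trial, and the number of rounds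
of that trial; the guesses used in that layer for the final reduction of the number of colors. -/
structure Plan (G : Type) where
  palette : ℕ → ℕ
  trialGuess : (layer : ℕ) → (trial : ℕ) → G
  trialTime : (trial : ℕ) → ℕ
  finalGuess : (layer : ℕ) → G

/-- The output colors of the layer `k` are the integers in `(offset k, offset (k + 1)]`; the first
`palette k` of them are for the nodes that keep their initial color. -/
def Plan.offset {G : Type} (P : Plan G) (k : ℕ) : ℕ := ∑ j ∈ Finset.range k, 2 * P.palette j

/-- The state of a node.  `pair` is the provisional color once it is fixed, `ports` tells which
ports currently lead to nodes that take part in the simulated execution, `cur` is the simulated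
state in the current trial.  In the final reduction, the first `len` simulated states are known,
and they are the values of `hist` at `0, …, len - 1`. -/
structure NodeState (σ : Type) where
  degree : ℕ
  ident : ℕ
  color : ℕ
  trial : ℕ
  clock : ℕ
  pair : Option (ℕ × ℕ)
  ports : List Bool
  cur : σ
  len : ℕ
  hist : ℕ → σ

namespace NodeState

variable {σ : Type}

/-- The degree layer of a node: its degree is at most `2 ^ layer`. -/
def layer (s : NodeState σ) : ℕ := Nat.clog 2 s.degree

/-- `s'` belongs to the same layer as `s` and its initial color is outside of the palette. -/
def isPeer (K : ℕ → ℕ) (s s' : NodeState σ) : Bool :=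
  decide (s'.layer = s.layer) && decide (K s'.layer < s'.color)

/-- `s'` is a peer of `s` whose provisional color is not fixed yet. -/
def isRival (K : ℕ → ℕ) (s s' : NodeState σ) : Bool :=
  s.isPeer K s' && s'.pair.isNone

/-- The simulated state after `r` rounds is known, either explicitly or because the simulated
execution has terminated before. -/
def Knows {G : Type} (A : LocalAlgorithm G) (s : NodeState A.State) (r : ℕ) : Prop :=
  s.len ≠ 0 ∧ (r < s.len ∨ (A.out (s.hist (s.len - 1))).isSome)

/-- The simulated state after `r` rounds, provided that it is known. -/
def stateAt (s : NodeState σ) (r : ℕ) : σ := s.hist (min r (s.len - 1))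

end NodeState

theorem exists_fresh (L : List ℕ) : ∃ b, b ≤ L.length ∧ b ∉ L := by
  by_contra! h
  have : Finset.range (L.length + 1) ⊆ L.toFinset := fun b hb =>
    List.mem_toFinset.2 (h b (Nat.lt_succ_iff.1 (Finset.mem_range.1 hb)))
  have h1 := Finset.card_le_card this
  have h2 := L.toFinset_card_le
  rw [Finset.card_range] at h1
  omega

/-- A number at most the length of `L` that does not occur in `L`. -/
noncomputable def fresh (L : List ℕ) : ℕ := (exists_fresh L).choose

section

variable {G : Type} (A : LocalAlgorithm G) (P : Plan G)

/-- The messages that a simulated node receives from the neighbors selected by `p`, when the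
simulated state of a neighbor is given by `cur`. -/
def relay (p : NodeState A.State → Bool) (cur : NodeState A.State → A.State)
    (l : List (NodeState A.State × ℕ)) : List (Option A.Msg) :=
  (l.filter fun x => p x.1).map fun x =>
    if (A.out (cur x.1)).isSome then none
    else some (A.send (cur x.1) ((x.1.ports.take x.2).count true))

open Classical in
/-- The provisional color at the end of a trial.  It is fixed if the trial has produced a color of
the palette that differs from those of all rivals; the second component then serves to distinguish
it from the provisional colors fixed in the previous trials. -/
noncomputable def newPair (s : NodeState A.State) (l : List (NodeState A.State × ℕ)) :
    Option (ℕ × ℕ) :=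
  (A.out s.cur).bind fun c =>
    if 1 ≤ c ∧ c ≤ P.palette s.layer ∧
        ∀ x ∈ l, s.isRival P.palette x.1 = true → A.out x.1.cur ≠ some c then
      some (c, fresh (l.filterMap fun x => x.1.pair.map Prod.snd))
    else none

/-- The output of a node, once it is determined. -/
def nodeOut (s : NodeState A.State) : Option ℕ :=
  if P.palette s.layer < s.color then
    if s.len = 0 then none
    else (A.out (s.hist (s.len - 1))).map
      fun y => P.offset s.layer + (P.palette s.layer + y)
  else some (P.offset s.layer + s.color)

/-- One round of a trial. -/
noncomputable def trialStep (s : NodeState A.State) (l : List (NodeState A.State × ℕ)) :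
    NodeState A.State :=
  if s.clock = 0 then
    { s with
      clock := 1
      ports := l.map fun x => s.isRival P.palette x.1
      cur := A.init (P.trialGuess s.layer s.trial)
        ((l.map fun x => s.isRival P.palette x.1).count true) s.ident s.color }
  else if s.clock ≤ P.trialTime s.trial then
    { s with
      clock := s.clock + 1
      cur := if (A.out s.cur).isSome then s.cur
        else A.step s.cur (relay A (s.isRival P.palette) NodeState.cur l) }
  else
    { s with
      clock := 0
      trial := s.trial + 1
      pair := newPair A P s l }

open Classical in
/-- One round of the final reduction for a node with provisional color `c`.  The next round of the
simulated execution is performed as soon as all peers have performed the previous one. -/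
noncomputable def finalStep (c : ℕ × ℕ) (s : NodeState A.State)
    (l : List (NodeState A.State × ℕ)) : NodeState A.State :=
  if s.len = 0 then
    { s with
      ports := l.map fun x => s.isPeer P.palette x.1
      len := 1
      hist := fun _ => A.init (P.finalGuess s.layer)
        ((l.map fun x => s.isPeer P.palette x.1).count true) s.ident (Nat.pair c.1 c.2 + 1) }
  else if ∀ x ∈ l, s.isPeer P.palette x.1 = true → x.1.Knows A (s.len - 1) then
    { s with
      len := s.len + 1
      hist := Function.update s.hist s.len (A.step (s.hist (s.len - 1))
        (relay A (s.isPeer P.palette) (fun s' => s'.stateAt (s.len - 1)) l)) }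
  else s

/-- One round of a node. -/
noncomputable def nodeStep (s : NodeState A.State) (l : List (NodeState A.State × ℕ)) :
    NodeState A.State :=
  if (nodeOut A P s).isSome then s
  else match s.pair with
    | none => trialStep A P s l
    | some c => finalStep A P c s l

/-- The uniform coloring machine.  A node whose initial color lies in the palette of its layer
keeps that color.  The other nodes first obtain provisional colors by a sequence of trials, and
then reduce the number of colors by one more simulated execution of `A`, in which the provisional
colors are the initial colors. -/
noncomputable def coloringMachine : BroadcastMachine where
  State := NodeState A.State
  init d i c :=
    { degree := d
      ident := i
      color := c
      trial := 0
      clock := 0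
      pair := none
      ports := []
      cur := A.init (P.trialGuess 0 0) d i c
      len := 0
      hist := fun _ => A.init (P.trialGuess 0 0) d i c }
  step := nodeStep A P
  out := nodeOut A P
  step_of_out _ _ h := if_pos h

variable {A P}

theorem fresh_le (L : List ℕ) : fresh L ≤ L.length := (exists_fresh L).choose_spec.1

theorem fresh_notMem (L : List ℕ) : fresh L ∉ L := (exists_fresh L).choose_spec.2

theorem newPair_eq_some {s : NodeState A.State} {l : List (NodeState A.State × ℕ)}
    {q : ℕ × ℕ} (h : newPair A P s l = some q) :
    A.out s.cur = some q.1 ∧ 1 ≤ q.1 ∧ q.1 ≤ P.palette s.layer ∧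
    (∀ x ∈ l, s.isRival P.palette x.1 = true → A.out x.1.cur ≠ some q.1) ∧
    q.2 ≤ l.length ∧ ∀ x ∈ l, ∀ q', x.1.pair = some q' → q ≠ q' := by
  obtain ⟨c, hc, h⟩ := Option.bind_eq_some_iff.1 h
  split_ifs at h with h'
  obtain rfl := Option.some.inj h
  refine ⟨hc, h'.1, h'.2.1, h'.2.2, (fresh_le _).trans (List.length_filterMap_le _ _), ?_⟩
  rintro x hx q' hq' rfl
  refine fresh_notMem (l.filterMap fun x => x.1.pair.map Prod.snd) ?_
  exact List.mem_filterMap.2 ⟨x, hx, by rw [hq']; rfl⟩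

theorem newPair_isSome {s : NodeState A.State} {l : List (NodeState A.State × ℕ)} {c : ℕ}
    (hc : A.out s.cur = some c) (h1 : 1 ≤ c) (h2 : c ≤ P.palette s.layer)
    (h3 : ∀ x ∈ l, s.isRival P.palette x.1 = true → A.out x.1.cur ≠ some c) :
    (newPair A P s l).isSome := by
  rw [newPair, hc, Option.bind_some, if_pos ⟨h1, h2, h3⟩]
  rfl

/-! ### Basic properties of the states -/

variable (A P) (I : Instance) (ports : ℕ → List ℕ)

/-- The state of a node of the coloring machine after `t` rounds. -/
noncomputable def nodeAt (t v : ℕ) : NodeState A.State :=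
  (coloringMachine A P).run I ports t v

/-- What a node of the coloring machine sees in round `t`. -/
noncomputable def seenAt (t v : ℕ) : List (NodeState A.State × ℕ) :=
  (ports v).map fun u => (nodeAt A P I ports t u, (ports u).idxOf v)

theorem nodeAt_of_out {t v : ℕ} (h : (nodeOut A P (nodeAt A P I ports t v)).isSome) :
    nodeAt A P I ports (t + 1) v = nodeAt A P I ports t v :=
  (coloringMachine A P).step_of_out _ _ h

theorem nodeAt_trial {t v : ℕ} (h : nodeOut A P (nodeAt A P I ports t v) = none)
    (h' : (nodeAt A P I ports t v).pair = none) :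
    nodeAt A P I ports (t + 1) v =
      trialStep A P (nodeAt A P I ports t v) (seenAt A P I ports t v) := by
  change nodeStep A P (nodeAt A P I ports t v) (seenAt A P I ports t v) = _
  rw [nodeStep, if_neg (by simp [h]), h']

theorem nodeAt_final {t v : ℕ} {c : ℕ × ℕ} (h : nodeOut A P (nodeAt A P I ports t v) = none)
    (h' : (nodeAt A P I ports t v).pair = some c) :
    nodeAt A P I ports (t + 1) v =
      finalStep A P c (nodeAt A P I ports t v) (seenAt A P I ports t v) := by
  change nodeStep A P (nodeAt A P I ports t v) (seenAt A P I ports t v) = _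
  rw [nodeStep, if_neg (by simp [h]), h']

/-- A property of states that is preserved by the two kinds of steps is preserved by a round. -/
theorem nodeAt_succ_induction {motive : NodeState A.State → Prop} {t v : ℕ}
    (stay : motive (nodeAt A P I ports t v))
    (trial : (nodeAt A P I ports t v).pair = none → ∀ l,
      motive (trialStep A P (nodeAt A P I ports t v) l))
    (final : ∀ c, (nodeAt A P I ports t v).pair = some c → ∀ l,
      motive (finalStep A P c (nodeAt A P I ports t v) l)) :
    motive (nodeAt A P I ports (t + 1) v) := by
  by_cases h : nodeOut A P (nodeAt A P I ports t v) = none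
  · cases h' : (nodeAt A P I ports t v).pair with
    | none => rw [nodeAt_trial A P I ports h h']; exact trial h' _
    | some c => rw [nodeAt_final A P I ports h h']; exact final c h' _
  · rw [nodeAt_of_out A P I ports (Option.isSome_iff_ne_none.2 h)]
    exact stay

theorem nodeAt_data (t v : ℕ) :
    (nodeAt A P I ports t v).degree = (ports v).length ∧
    (nodeAt A P I ports t v).ident = I.ident v ∧
    (nodeAt A P I ports t v).color = I.color v := by
  induction t with
  | zero => exact ⟨rfl, rfl, rfl⟩
  | succ t ih =>
    refine nodeAt_succ_induction A P I ports
      (motive := fun s => s.degree = (ports v).length ∧ s.ident = I.ident v ∧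
        s.color = I.color v) ih (fun _ l => ?_) (fun c _ l => ?_)
    · unfold trialStep; split_ifs <;> exact ih
    · unfold finalStep; split_ifs <;> exact ih

theorem layer_nodeAt (t v : ℕ) :
    (nodeAt A P I ports t v).layer = Nat.clog 2 (ports v).length := by
  rw [NodeState.layer, (nodeAt_data A P I ports t v).1]

theorem pair_nodeAt_of_le {t t' v : ℕ} {c : ℕ × ℕ} (ht : t ≤ t')
    (h : (nodeAt A P I ports t v).pair = some c) : (nodeAt A P I ports t' v).pair = some c := by
  induction t', ht using Nat.le_induction with
  | base => exact h
  | succ n _ ih =>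
    refine nodeAt_succ_induction A P I ports (motive := fun s => s.pair = some c) ih
      (fun h' l => by simp [h'] at ih) (fun c' _ l => ?_)
    unfold finalStep; split_ifs <;> exact ih

/-- The final reduction starts after the provisional color has been fixed only. -/
theorem len_eq_zero_of_pair {t v : ℕ} (h : (nodeAt A P I ports t v).pair = none) :
    (nodeAt A P I ports t v).len = 0 := by
  induction t with
  | zero => rfl
  | succ t ih =>
    have h' : (nodeAt A P I ports t v).pair = none := by
      cases h' : (nodeAt A P I ports t v).pair with
      | none => rfl
      | some c => rw [pair_nodeAt_of_le A P I ports (Nat.le_succ t) h'] at h; simp at h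
    refine nodeAt_succ_induction A P I ports (motive := fun s => s.len = 0) (ih h')
      (fun _ l => ?_) (fun c hc l => by simp [h'] at hc)
    unfold trialStep; split_ifs <;> exact ih h'

/-- The nodes of the layer `k` whose initial colors lie outside of the palette. -/
def contenders (K : ℕ → ℕ) (k : ℕ) : Finset ℕ :=
  I.verts.filter fun v => Nat.clog 2 (ports v).length = k ∧ K k < I.color v

variable {I ports}

theorem mem_contenders {K : ℕ → ℕ} {k v : ℕ} : v ∈ contenders I ports K k ↔
    v ∈ I.verts ∧ Nat.clog 2 (ports v).length = k ∧ K k < I.color v := by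
  rw [contenders, Finset.mem_filter]


theorem mem_verts_of_mem_ports (hports : IsPortNumbering I.toNetwork ports) {u v : ℕ}
    (hv : v ∈ I.verts) (h : u ∈ ports v) : u ∈ I.verts :=
  I.mem_of_adj _ _ (((hports v hv).2 u).1 h).symm

end

section

variable {G : Type} (A : LocalAlgorithm G) (P : Plan G) {I : Instance} {ports : ℕ → List ℕ}

/-! ### The trials -/

theorem isPeer_nodeAt {k u v : ℕ} (t t' : ℕ) (hv : v ∈ contenders I ports P.palette k)
    (hu : u ∈ I.verts) :
    (nodeAt A P I ports t v).isPeer P.palette (nodeAt A P I ports t' u) =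
      decide (u ∈ contenders I ports P.palette k) := by
  obtain ⟨-, hk, -⟩ := mem_contenders.1 hv
  rw [NodeState.isPeer, layer_nodeAt, layer_nodeAt, (nodeAt_data A P I ports t' u).2.2, hk,
    ← Bool.decide_and]
  refine decide_eq_decide.2 ⟨fun h => mem_contenders.2 ⟨hu, h.1, h.1 ▸ h.2⟩, fun h => ?_⟩
  obtain ⟨-, h1, h2⟩ := mem_contenders.1 h
  exact ⟨h1, h1.symm ▸ h2⟩

/-- If the selected neighbors are those in `W`, the relayed messages are those of the execution of
`A` on the subgraph induced by `W`. -/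
theorem relay_eq {p : NodeState A.State → Bool} {cur : NodeState A.State → A.State} {t v : ℕ}
    (W : Finset ℕ) (R : ℕ → A.State) (hv : v ∈ W)
    (hp : ∀ u ∈ ports v, p (nodeAt A P I ports t u) = decide (u ∈ W))
    (hR : ∀ u ∈ ports v, u ∈ W → cur (nodeAt A P I ports t u) = R u ∧
      (nodeAt A P I ports t u).ports = (ports u).map fun w => decide (w ∈ W)) :
    relay A p cur (seenAt A P I ports t v) = (portsIn ports W v).map fun u =>
      if (A.out (R u)).isSome then none
      else some (A.send (R u) ((portsIn ports W u).idxOf v)) := by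
  have e : (ports v).filter ((fun x => p x.1) ∘
      fun u => (nodeAt A P I ports t u, (ports u).idxOf v)) = portsIn ports W v :=
    List.filter_congr fun u hu => hp u hu
  rw [relay, seenAt, List.filter_map, List.map_map, e]
  refine List.map_congr_left fun u hu => ?_
  obtain ⟨h1, h2⟩ := List.mem_filter.1 hu
  obtain ⟨h3, h4⟩ := hR u h1 (of_decide_eq_true h2)
  have h5 := idxOf_filter (p := fun w => decide (w ∈ W)) (decide_eq_true hv) (ports u)
  simp only [Function.comp, h3, h4, portsIn, h5]

theorem length_portsIn (W : Finset ℕ) (v : ℕ) :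
    (portsIn ports W v).length = ((ports v).map fun u => decide (u ∈ W)).count true := by
  rw [portsIn, ← List.countP_eq_length_filter, List.count, List.countP_map]
  refine List.countP_congr fun u _ => ?_
  simp

/-- The sub-instance of `I` induced by a set of nodes. -/
def Instance.restrict (I : Instance) (W : Finset ℕ) (hW : W ⊆ I.verts) : Instance :=
  I.induce W I.color (fun v hv => I.color_pos v (hW hv)) (fun u _ v _ h => I.color_proper u v h)

/-- The contenders of the layer `k` whose provisional colors are not fixed before round `t`. -/
noncomputable def rivals (I : Instance) (ports : ℕ → List ℕ) (k t : ℕ) : Finset ℕ :=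
  (contenders I ports P.palette k).filter fun v => (nodeAt A P I ports t v).pair = none

theorem rivals_subset (I : Instance) (ports : ℕ → List ℕ) (k t : ℕ) :
    rivals A P I ports k t ⊆ I.verts :=
  (Finset.filter_subset _ _).trans (Finset.filter_subset _ _)

/-- The sub-instance on which a trial that starts in round `t` simulates `A`. -/
noncomputable def trialInstance (I : Instance) (ports : ℕ → List ℕ) (k t : ℕ) : Instance :=
  I.restrict (rivals A P I ports k t) (rivals_subset A P I ports k t)

/-- The round in which the `n`-th trial starts.  A trial spends one round on the identification of
the rivals, and one round on fixing provisional colors. -/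
def Plan.startTime {G : Type} (P : Plan G) (n : ℕ) : ℕ :=
  ∑ m ∈ Finset.range n, (P.trialTime m + 2)

/-- All contenders of the layer `k` without provisional colors are about to start trial `n`. -/
def TrialsInStep (I : Instance) (ports : ℕ → List ℕ) (k n : ℕ) : Prop :=
  ∀ v ∈ rivals A P I ports k (P.startTime n),
    (nodeAt A P I ports (P.startTime n) v).trial = n ∧
    (nodeAt A P I ports (P.startTime n) v).clock = 0

variable {A P}

theorem mem_rivals {k t v : ℕ} : v ∈ rivals A P I ports k t ↔
    v ∈ contenders I ports P.palette k ∧ (nodeAt A P I ports t v).pair = none := by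
  rw [rivals, Finset.mem_filter]

theorem nodeOut_of_rival {k t v : ℕ} (hv : v ∈ contenders I ports P.palette k)
    (h : (nodeAt A P I ports t v).pair = none) : nodeOut A P (nodeAt A P I ports t v) = none := by
  obtain ⟨-, h1, h2⟩ := mem_contenders.1 hv
  rw [nodeOut, layer_nodeAt, (nodeAt_data A P I ports t v).2.2, h1, if_pos h2,
    if_pos (len_eq_zero_of_pair A P I ports h)]

theorem isRival_nodeAt {k u v t t₀ : ℕ} (hv : v ∈ contenders I ports P.palette k)
    (hu : u ∈ I.verts) (h : u ∈ contenders I ports P.palette k →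
      ((nodeAt A P I ports t u).pair = none ↔ (nodeAt A P I ports t₀ u).pair = none)) :
    (nodeAt A P I ports t v).isRival P.palette (nodeAt A P I ports t u) =
      decide (u ∈ rivals A P I ports k t₀) := by
  rw [NodeState.isRival, isPeer_nodeAt A P t t hv hu, Bool.eq_iff_iff, Bool.and_eq_true,
    decide_eq_true_iff, decide_eq_true_iff, mem_rivals, Option.isNone_iff_eq_none]
  exact and_congr_right h

/-- During a trial, the simulated states are those of the execution of `A` on the sub-instance
induced by the contenders that have no provisional color yet. -/
theorem trial_simulates (hports : IsPortNumbering I.toNetwork ports) {k n : ℕ}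
    (h : TrialsInStep A P I ports k n) {i : ℕ} (hi : i ≤ P.trialTime n) {v : ℕ}
    (hv : v ∈ rivals A P I ports k (P.startTime n)) :
    let s := nodeAt A P I ports (P.startTime n + 1 + i) v
    s.pair = none ∧ s.trial = n ∧ s.clock = 1 + i ∧
    s.ports = (ports v).map (fun w => decide (w ∈ rivals A P I ports k (P.startTime n))) ∧
    s.cur = A.run (P.trialGuess k n) (trialInstance A P I ports k (P.startTime n))
      (portsIn ports (rivals A P I ports k (P.startTime n))) i v := by
  set t₀ := P.startTime n with ht₀
  set W := rivals A P I ports k t₀ with hW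
  induction i generalizing v with
  | zero =>
    obtain ⟨hc, hp⟩ := mem_rivals.1 hv
    obtain ⟨h1, h2⟩ := h v hv
    have hl := layer_nodeAt A P I ports t₀ v
    rw [(mem_contenders.1 hc).2.1] at hl
    obtain ⟨-, hid, hcol⟩ := nodeAt_data A P I ports t₀ v
    have e : (seenAt A P I ports t₀ v).map
        (fun x => (nodeAt A P I ports t₀ v).isRival P.palette x.1) =
        (ports v).map fun w => decide (w ∈ W) := by
      rw [seenAt, List.map_map]
      exact List.map_congr_left fun u hu => isRival_nodeAt hc
        (mem_verts_of_mem_ports hports (mem_contenders.1 hc).1 hu) fun _ => Iff.rfl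
    intro s
    have hs : s = _ := nodeAt_trial A P I ports (nodeOut_of_rival hc hp) hp
    rw [hs, trialStep, if_pos h2]
    refine ⟨hp, h1, rfl, e, ?_⟩
    simp only [e, hl, hid, hcol]
    rw [← length_portsIn]
    rw [show (nodeAt A P I ports t₀ v).trial = n from h1]
    rfl
  | succ i ih =>
    have ih' := fun {u} hu => ih (Nat.le_of_succ_le hi) (v := u) hu
    have hrival : ∀ u, u ∈ contenders I ports P.palette k →
        ((nodeAt A P I ports (t₀ + 1 + i) u).pair = none ↔
          (nodeAt A P I ports t₀ u).pair = none) := by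
      intro u hu
      refine ⟨fun h' => ?_, fun h' => (ih' (mem_rivals.2 ⟨hu, h'⟩)).1⟩
      cases h'' : (nodeAt A P I ports t₀ u).pair with
      | none => rfl
      | some c =>
        rw [pair_nodeAt_of_le A P I ports (by omega : t₀ ≤ t₀ + 1 + i) h''] at h'
        simp at h'
    obtain ⟨hc, -⟩ := mem_rivals.1 hv
    obtain ⟨h1, h2, h3, h4, h5⟩ := ih' hv
    rw [← Nat.add_assoc (t₀ + 1), nodeAt_trial A P I ports (nodeOut_of_rival hc h1) h1,
      trialStep, if_neg (by omega), if_pos (by rw [h2]; omega)]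
    refine ⟨h1, h2, by simp only; omega, h4, ?_⟩
    simp only
    rw [relay_eq A P W (A.run (P.trialGuess k n) (trialInstance A P I ports k t₀)
      (portsIn ports W) i) hv (fun u hu => isRival_nodeAt hc
        (mem_verts_of_mem_ports hports (mem_contenders.1 hc).1 hu) (hrival u))
      (fun u _ hu => ⟨(ih' hu).2.2.2.2, (ih' hu).2.2.2.1⟩), h5, LocalAlgorithm.run_succ]

theorem startTime_succ (n : ℕ) : P.startTime (n + 1) = P.startTime n + 1 + P.trialTime n + 1 := by
  rw [Plan.startTime, Finset.sum_range_succ]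
  change P.startTime n + _ = _
  omega

/-- The last round of a trial. -/
theorem trial_decides (hports : IsPortNumbering I.toNetwork ports) {k n : ℕ}
    (h : TrialsInStep A P I ports k n) {v : ℕ}
    (hv : v ∈ rivals A P I ports k (P.startTime n)) :
    let t := P.startTime n + 1 + P.trialTime n
    let s := nodeAt A P I ports (P.startTime (n + 1)) v
    s.trial = n + 1 ∧ s.clock = 0 ∧
    s.pair = newPair A P (nodeAt A P I ports t v) (seenAt A P I ports t v) := by
  intro t
  obtain ⟨hc, -⟩ := mem_rivals.1 hv
  obtain ⟨h1, h2, h3, -⟩ := trial_simulates hports h le_rfl hv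
  rw [startTime_succ, nodeAt_trial A P I ports (nodeOut_of_rival hc h1) h1, trialStep,
    if_neg (by omega), if_neg (by rw [h2]; omega)]
  exact ⟨by simp only; rw [h2], rfl, rfl⟩

theorem pair_eq_none_of_le {t t' v : ℕ} (ht : t ≤ t')
    (h : (nodeAt A P I ports t' v).pair = none) : (nodeAt A P I ports t v).pair = none := by
  cases h' : (nodeAt A P I ports t v).pair with
  | none => rfl
  | some c => rw [pair_nodeAt_of_le A P I ports ht h'] at h; simp at h

theorem trialsInStep (hports : IsPortNumbering I.toNetwork ports) (k n : ℕ) :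
    TrialsInStep A P I ports k n := by
  induction n with
  | zero => exact fun v _ => ⟨rfl, rfl⟩
  | succ n ih =>
    intro v hv
    obtain ⟨hc, hp⟩ := mem_rivals.1 hv
    have := trial_decides hports ih (mem_rivals.2 ⟨hc, pair_eq_none_of_le (by
      rw [startTime_succ]; omega) hp⟩)
    exact ⟨this.1, this.2.1⟩

/-- The provisional colors fixed before trial `n` are of bounded size and proper. -/
theorem pairs_proper (hports : IsPortNumbering I.toNetwork ports) (k n : ℕ) :
    (∀ v ∈ contenders I ports P.palette k, ∀ q,
      (nodeAt A P I ports (P.startTime n) v).pair = some q →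
        q.1 ≤ P.palette k ∧ q.2 ≤ (ports v).length) ∧
    (∀ u ∈ contenders I ports P.palette k, ∀ v ∈ contenders I ports P.palette k,
      I.graph.Adj u v → ∀ q, (nodeAt A P I ports (P.startTime n) u).pair = some q →
        (nodeAt A P I ports (P.startTime n) v).pair ≠ some q) := by
  induction n with
  | zero => exact ⟨fun v _ q h => by simp [nodeAt, Plan.startTime, BroadcastMachine.run,
      coloringMachine] at h, fun u _ v _ _ q h => by simp [nodeAt, Plan.startTime,
      BroadcastMachine.run, coloringMachine] at h⟩
  | succ n ih =>
    have hstep := trialsInStep (A := A) (P := P) hports k n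
    have hle : P.startTime n ≤ P.startTime (n + 1) := by rw [startTime_succ]; omega
    set t := P.startTime n + 1 + P.trialTime n with ht
    -- a provisional color is either old, or it has just been fixed
    have key : ∀ v ∈ contenders I ports P.palette k, ∀ q,
        (nodeAt A P I ports (P.startTime (n + 1)) v).pair = some q →
        (nodeAt A P I ports (P.startTime n) v).pair = some q ∨
        v ∈ rivals A P I ports k (P.startTime n) ∧
        newPair A P (nodeAt A P I ports t v) (seenAt A P I ports t v) = some q := by
      intro v hv q hq
      cases h : (nodeAt A P I ports (P.startTime n) v).pair with
      | none =>
        have hv' := mem_rivals.2 ⟨hv, h⟩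
        exact Or.inr ⟨hv', (trial_decides hports hstep hv').2.2 ▸ hq⟩
      | some c =>
        rw [pair_nodeAt_of_le A P I ports hle h] at hq
        exact Or.inl hq
    have seen : ∀ u ∈ I.verts, ∀ v, I.graph.Adj u v →
        (nodeAt A P I ports t v, (ports v).idxOf u) ∈ seenAt A P I ports t u :=
      fun u hu v huv => List.mem_map.2 ⟨v, ((hports u hu).2 v).2 huv, rfl⟩
    -- a node that has just fixed its provisional color knows the old ones of its neighbors
    have mixed : ∀ u ∈ I.verts, ∀ v, I.graph.Adj u v → ∀ q,
        newPair A P (nodeAt A P I ports t u) (seenAt A P I ports t u) = some q →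
        (nodeAt A P I ports (P.startTime n) v).pair ≠ some q := fun u hu v huv q hq hq' =>
      (newPair_eq_some hq).2.2.2.2.2 _ (seen u hu v huv) q
        (pair_nodeAt_of_le A P I ports (by omega) hq') rfl
    refine ⟨fun v hv q hq => ?_, fun u hu v hv huv q hqu hqv => ?_⟩
    · rcases key v hv q hq with hq | ⟨-, hq⟩
      · exact ih.1 v hv q hq
      · have := newPair_eq_some hq
        rw [layer_nodeAt, (mem_contenders.1 hv).2.1] at this
        exact ⟨this.2.2.1, by simpa [seenAt] using this.2.2.2.2.1⟩
    · have hu' := (mem_contenders.1 hu).1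
      have hv' := (mem_contenders.1 hv).1
      rcases key u hu q hqu with hqu | ⟨hru, hqu⟩ <;> rcases key v hv q hqv with hqv | ⟨hrv, hqv⟩
      · exact ih.2 u hu v hv huv q hqu hqv
      · exact mixed v hv' u huv.symm q hqv hqu
      · exact mixed u hu' v huv q hqu hqv
      · have hpv := (trial_simulates hports hstep le_rfl hrv).1
        refine (newPair_eq_some hqu).2.2.2.1 _ (seen u hu' v huv) ?_ (newPair_eq_some hqv).1
        rw [NodeState.isRival, isPeer_nodeAt A P t t hu hv']
        simp [hv, hpv, ht]

/-- A trial with good guesses and enough time fixes all provisional colors. -/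
theorem pair_isSome_of_colorsWithin (hports : IsPortNumbering I.toNetwork ports) {k n : ℕ}
    {K T : ℝ} (h : A.ColorsWithin (P.trialGuess k n) (trialInstance A P I ports k (P.startTime n))
      (portsIn ports (rivals A P I ports k (P.startTime n))) K T)
    (hK : K < P.palette k + 1) (hT : T ≤ P.trialTime n) {v : ℕ}
    (hv : v ∈ contenders I ports P.palette k) :
    (nodeAt A P I ports (P.startTime (n + 1)) v).pair.isSome := by
  have hstep := trialsInStep (A := A) (P := P) hports k n
  have hle : P.startTime n ≤ P.startTime (n + 1) := by rw [startTime_succ]; omega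
  cases hp : (nodeAt A P I ports (P.startTime n) v).pair with
  | some c => rw [pair_nodeAt_of_le A P I ports hle hp]; rfl
  | none =>
    have hr := mem_rivals.2 ⟨hv, hp⟩
    obtain ⟨t', ht', y, hy1, hy2, hy3⟩ := h
    have htt : t' ≤ P.trialTime n := by exact_mod_cast ht'.trans hT
    have out : ∀ u ∈ rivals A P I ports k (P.startTime n),
        A.out (nodeAt A P I ports (P.startTime n + 1 + P.trialTime n) u).cur = some (y u) := by
      intro u hu
      have hu' : u ∈ (trialInstance A P I ports k (P.startTime n)).verts :=
        Finset.mem_inter.2 ⟨rivals_subset A P I ports k _ hu, hu⟩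
      rw [(trial_simulates hports hstep le_rfl hu).2.2.2.2,
        A.run_of_out _ _ _ (by rw [hy1 u hu']; rfl) htt, hy1 u hu']
    have hv' : v ∈ (trialInstance A P I ports k (P.startTime n)).verts :=
      Finset.mem_inter.2 ⟨rivals_subset A P I ports k _ hr, hr⟩
    rw [(trial_decides hports hstep hr).2.2]
    refine newPair_isSome (out v hr) (hy2 v hv').1 ?_ fun x hx hxr => ?_
    · rw [layer_nodeAt, (mem_contenders.1 hv).2.1]
      have := (hy2 v hv').2.trans_lt hK
      exact Nat.lt_succ_iff.1 (by exact_mod_cast this)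
    · obtain ⟨u, hu, rfl⟩ := List.mem_map.1 hx
      have huv := mem_verts_of_mem_ports hports (mem_contenders.1 hv).1 hu
      rw [NodeState.isRival, isPeer_nodeAt A P _ _ hv huv, Bool.and_eq_true,
        decide_eq_true_iff, Option.isNone_iff_eq_none] at hxr
      have hur : u ∈ rivals A P I ports k (P.startTime n) :=
        mem_rivals.2 ⟨hxr.1, pair_eq_none_of_le (by omega) hxr.2⟩
      rw [out u hur]
      intro e
      exact hy3 v u ⟨((hports v (mem_contenders.1 hv).1).2 u).1 hu, hr, hur⟩
        (Option.some.inj e).symm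

end

section

variable {G : Type} {A : LocalAlgorithm G} {P : Plan G} {I : Instance} {ports : ℕ → List ℕ}

/-! ### The final reduction of the number of colors -/

theorem nodeOut_of_contender {k t v : ℕ} (hv : v ∈ contenders I ports P.palette k)
    (h : (nodeAt A P I ports t v).len ≠ 0) :
    nodeOut A P (nodeAt A P I ports t v) =
      (A.out ((nodeAt A P I ports t v).hist ((nodeAt A P I ports t v).len - 1))).map
        fun y => P.offset k + (P.palette k + y) := by
  obtain ⟨-, h1, h2⟩ := mem_contenders.1 hv
  rw [nodeOut, layer_nodeAt, (nodeAt_data A P I ports t v).2.2, h1, if_pos h2, if_neg h]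

/-- The simulated states known to a node are those of the execution of `A` on the sub-instance
induced by all contenders, with the provisional colors as initial colors. -/
theorem final_simulates (hports : IsPortNumbering I.toNetwork ports) {k : ℕ} {χ : ℕ → ℕ}
    {hpos} {hproper}
    (hχ : ∀ t, ∀ v ∈ contenders I ports P.palette k, ∀ q,
      (nodeAt A P I ports t v).pair = some q → Nat.pair q.1 q.2 + 1 = χ v)
    (t : ℕ) {v : ℕ} (hv : v ∈ contenders I ports P.palette k)
    (hlen : (nodeAt A P I ports t v).len ≠ 0) :
    (nodeAt A P I ports t v).ports =
      (ports v).map (fun w => decide (w ∈ contenders I ports P.palette k)) ∧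
    ∀ r < (nodeAt A P I ports t v).len, (nodeAt A P I ports t v).hist r =
      A.run (P.finalGuess k) (I.induce (contenders I ports P.palette k) χ hpos hproper)
        (portsIn ports (contenders I ports P.palette k)) r v := by
  set W := contenders I ports P.palette k with hW
  set R := A.run (P.finalGuess k) (I.induce W χ hpos hproper) (portsIn ports W) with hR
  induction t generalizing v with
  | zero => exact absurd rfl hlen
  | succ t ih =>
    by_cases ho : (nodeOut A P (nodeAt A P I ports t v)).isSome
    · rw [nodeAt_of_out A P I ports ho] at hlen ⊢
      exact ih hlen hv
    rw [Option.not_isSome_iff_eq_none] at ho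
    cases hp : (nodeAt A P I ports t v).pair with
    | none =>
      rw [nodeAt_trial A P I ports ho hp] at hlen
      refine absurd ?_ hlen
      unfold trialStep
      split_ifs <;> exact len_eq_zero_of_pair A P I ports hp
    | some c =>
      have hl := layer_nodeAt A P I ports t v
      rw [(mem_contenders.1 hv).2.1] at hl
      have hpeer : ∀ u ∈ ports v, (nodeAt A P I ports t v).isPeer P.palette
          (nodeAt A P I ports t u) = decide (u ∈ W) := fun u hu =>
        isPeer_nodeAt A P t t hv (mem_verts_of_mem_ports hports (mem_contenders.1 hv).1 hu)
      rw [nodeAt_final A P I ports ho hp, finalStep] at hlen ⊢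
      by_cases h0 : (nodeAt A P I ports t v).len = 0
      · have e : (seenAt A P I ports t v).map
            (fun x => (nodeAt A P I ports t v).isPeer P.palette x.1) =
            (ports v).map fun w => decide (w ∈ W) := by
          rw [seenAt, List.map_map]
          exact List.map_congr_left hpeer
        rw [if_pos h0]
        refine ⟨e, fun r hr => ?_⟩
        obtain rfl : r = 0 := Nat.lt_one_iff.1 hr
        simp only [e, hl, (nodeAt_data A P I ports t v).2.1, hχ t v hv c hp]
        rw [← length_portsIn]
        rfl
      · rw [if_neg h0] at hlen ⊢
        split_ifs with hready
        · refine ⟨(ih h0 hv).1, fun r hr => ?_⟩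
          simp only at hr ⊢
          by_cases hr' : r < (nodeAt A P I ports t v).len
          · rw [Function.update_of_ne hr'.ne]
            exact (ih h0 hv).2 r hr'
          obtain ⟨j, hj⟩ := Nat.exists_eq_succ_of_ne_zero h0
          obtain rfl : r = j + 1 := by omega
          have hlast := (ih h0 hv).2 j (by omega)
          rw [nodeOut_of_contender hv h0, hj, Nat.succ_sub_one, hlast, Option.map_eq_none_iff]
            at ho
          rw [hj, Function.update_self, Nat.succ_sub_one, hlast]
          rw [hj, Nat.succ_sub_one] at hready
          rw [relay_eq A P W (R j) hv hpeer fun u hu huW => ?_, hR, LocalAlgorithm.run_succ,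
            if_neg (by rw [← hR, ho]; simp)]
          · have hk : (nodeAt A P I ports t u).Knows A j := hready _ (List.mem_map.2 ⟨u, hu, rfl⟩)
              (by rw [hpeer u hu]; exact decide_eq_true huW)
            obtain ⟨hu0, hk⟩ := hk
            obtain ⟨ih1, ih2⟩ := ih hu0 huW
            refine ⟨?_, ih1⟩
            by_cases hju : j < (nodeAt A P I ports t u).len
            · rw [NodeState.stateAt, min_eq_left (by omega), ih2 j hju]
            · have hk := hk.resolve_left hju
              rw [ih2 _ (by omega)] at hk
              rw [NodeState.stateAt, min_eq_right (by omega), ih2 _ (by omega)]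
              exact (A.run_of_out _ _ _ hk (by omega)).symm
        · rw [if_neg hready] at hlen
          exact ih h0 hv

theorem knows_succ {k t v r : ℕ} (hv : v ∈ contenders I ports P.palette k)
    (h : (nodeAt A P I ports t v).Knows A r) : (nodeAt A P I ports (t + 1) v).Knows A r := by
  by_cases ho : (nodeOut A P (nodeAt A P I ports t v)).isSome
  · rwa [nodeAt_of_out A P I ports ho]
  rw [Option.not_isSome_iff_eq_none] at ho
  cases hp : (nodeAt A P I ports t v).pair with
  | none => exact absurd (len_eq_zero_of_pair A P I ports hp) h.1
  | some c =>
    rw [nodeAt_final A P I ports ho hp, finalStep, if_neg h.1]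
    split_ifs
    · rw [nodeOut_of_contender hv h.1, Option.map_eq_none_iff] at ho
      have := h.2.resolve_right (by simp [ho])
      exact ⟨Nat.succ_ne_zero _, Or.inl (Nat.lt_succ_of_lt this)⟩
    · exact h

/-- Once all contenders have provisional colors, the final reduction proceeds by one simulated
round in every round. -/
theorem knows_of_pairs (hports : IsPortNumbering I.toNetwork ports) {k t₁ : ℕ}
    (hpair : ∀ v ∈ contenders I ports P.palette k, (nodeAt A P I ports t₁ v).pair.isSome)
    (i : ℕ) {v : ℕ} (hv : v ∈ contenders I ports P.palette k) :
    (nodeAt A P I ports (t₁ + 1 + i) v).Knows A i := by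
  have hpair' : ∀ t, t₁ ≤ t → ∀ v ∈ contenders I ports P.palette k, ∃ c,
      (nodeAt A P I ports t v).pair = some c := fun t ht v hv => by
    obtain ⟨c, hc⟩ := Option.isSome_iff_exists.1 (hpair v hv)
    exact ⟨c, pair_nodeAt_of_le A P I ports ht hc⟩
  induction i generalizing v with
  | zero =>
    obtain ⟨c, hc⟩ := hpair' t₁ le_rfl v hv
    by_cases h0 : (nodeAt A P I ports t₁ v).len = 0
    · have ho : nodeOut A P (nodeAt A P I ports t₁ v) = none := by
        obtain ⟨-, h1, h2⟩ := mem_contenders.1 hv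
        rw [nodeOut, layer_nodeAt, (nodeAt_data A P I ports t₁ v).2.2, h1, if_pos h2, if_pos h0]
      rw [Nat.add_zero, nodeAt_final A P I ports ho hc, finalStep, if_pos h0]
      exact ⟨one_ne_zero, Or.inl one_pos⟩
    · exact knows_succ hv ⟨h0, Or.inl (Nat.pos_of_ne_zero h0)⟩
  | succ i ih =>
    obtain ⟨h0, h1⟩ := ih hv
    rw [← Nat.add_assoc]
    by_cases ho : (A.out ((nodeAt A P I ports (t₁ + 1 + i) v).hist
        ((nodeAt A P I ports (t₁ + 1 + i) v).len - 1))).isSome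
    · exact knows_succ hv ⟨h0, Or.inr ho⟩
    have h1 := h1.resolve_right ho
    by_cases h2 : i + 1 < (nodeAt A P I ports (t₁ + 1 + i) v).len
    · exact knows_succ hv ⟨h0, Or.inl h2⟩
    obtain ⟨c, hc⟩ := hpair' (t₁ + 1 + i) (by omega) v hv
    rw [nodeAt_final A P I ports (by
      rw [nodeOut_of_contender hv h0, Option.map_eq_none_iff]
      simpa using ho) hc, finalStep, if_neg h0, if_pos]
    · exact ⟨Nat.succ_ne_zero _, Or.inl (by simp only; omega)⟩
    · intro x hx hxp
      obtain ⟨u, hu, rfl⟩ := List.mem_map.1 hx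
      rw [isPeer_nodeAt A P _ _ hv (mem_verts_of_mem_ports hports (mem_contenders.1 hv).1 hu),
        decide_eq_true_iff] at hxp
      have := ih hxp
      rwa [show (nodeAt A P I ports (t₁ + 1 + i) v).len - 1 = i by omega]

/-- The outputs of the contenders of a layer. -/
theorem nodeOut_of_colorsWithin (hports : IsPortNumbering I.toNetwork ports) {k t₁ : ℕ}
    (hpair : ∀ v ∈ contenders I ports P.palette k, (nodeAt A P I ports t₁ v).pair.isSome)
    {χ : ℕ → ℕ} {hpos} {hproper}
    (hχ : ∀ t, ∀ v ∈ contenders I ports P.palette k, ∀ q,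
      (nodeAt A P I ports t v).pair = some q → Nat.pair q.1 q.2 + 1 = χ v)
    {y : ℕ → ℕ} {t₂ : ℕ}
    (hy : ∀ v ∈ contenders I ports P.palette k,
      A.out (A.run (P.finalGuess k) (I.induce (contenders I ports P.palette k) χ hpos hproper)
        (portsIn ports (contenders I ports P.palette k)) t₂ v) = some (y v))
    {v : ℕ} (hv : v ∈ contenders I ports P.palette k) :
    nodeOut A P (nodeAt A P I ports (t₁ + 1 + t₂) v) =
      some (P.offset k + (P.palette k + y v)) := by
  obtain ⟨h0, h1⟩ := knows_of_pairs hports hpair t₂ hv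
  have hs := (final_simulates hports (hpos := hpos) (hproper := hproper) hχ (t₁ + 1 + t₂) hv h0).2
  have hyv := hy v hv
  rw [nodeOut_of_contender hv h0, hs _ (by omega)]
  have : A.run (P.finalGuess k) (I.induce (contenders I ports P.palette k) χ hpos hproper)
      (portsIn ports (contenders I ports P.palette k))
      ((nodeAt A P I ports (t₁ + 1 + t₂) v).len - 1) v =
      A.run (P.finalGuess k) (I.induce (contenders I ports P.palette k) χ hpos hproper)
      (portsIn ports (contenders I ports P.palette k)) t₂ v := by
    rcases le_total t₂ ((nodeAt A P I ports (t₁ + 1 + t₂) v).len - 1) with h | h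
    · exact A.run_of_out _ _ _ (by rw [hyv]; rfl) h
    · rcases h1 with h1 | h1
      · congr 1; omega
      · rw [hs _ (by omega)] at h1
        exact (A.run_of_out _ _ _ h1 h).symm
  rw [this, hyv]
  rfl

end

section

variable {G : Type} {A : LocalAlgorithm G} {P : Plan G} {I : Instance} {ports : ℕ → List ℕ}

/-! ### Correctness of the coloring machine -/

theorem nodeOut_of_small {t v : ℕ}
    (h : I.color v ≤ P.palette (Nat.clog 2 (ports v).length)) :
    nodeOut A P (nodeAt A P I ports t v) =
      some (P.offset (Nat.clog 2 (ports v).length) + I.color v) := by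
  rw [nodeOut, layer_nodeAt, (nodeAt_data A P I ports t v).2.2, if_neg (by omega)]

theorem offset_succ (k : ℕ) :
    P.offset (k + 1) = P.offset k + 2 * P.palette k := Finset.sum_range_succ ..

theorem offset_mono : Monotone P.offset := fun _ _ h =>
  Finset.sum_le_sum_of_subset (Finset.range_mono h)

/-- If one of the trials that end until round `T₁` succeeds on all sub-instances of the contenders
of a layer, and if the final reduction takes at most `T₂` simulated rounds, then the contenders of
that layer output a proper coloring. -/
theorem contenders_output (hports : IsPortNumbering I.toNetwork ports)
    (hpal : ∀ k, 2 ^ k ≤ P.palette k) {T₁ T₂ k : ℕ}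
    (htrial : ∃ n, P.startTime (n + 1) ≤ T₁ ∧ ∀ W (hW : W ⊆ I.verts),
      W ⊆ contenders I ports P.palette k → ∃ K T : ℝ,
        A.ColorsWithin (P.trialGuess k n) (I.restrict W hW) (portsIn ports W) K T ∧
        K < P.palette k + 1 ∧ T ≤ P.trialTime n)
    (hfinal : ∀ χ hpos hproper,
      (∀ v ∈ contenders I ports P.palette k, χ v ≤ (P.palette k + 1) ^ 2) →
      ∃ K T : ℝ, A.ColorsWithin (P.finalGuess k)
        (I.induce (contenders I ports P.palette k) χ hpos hproper)
        (portsIn ports (contenders I ports P.palette k)) K T ∧ K < P.palette k + 1 ∧ T ≤ T₂) :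
    ∃ y : ℕ → ℕ, (∀ v ∈ contenders I ports P.palette k,
      nodeOut A P (nodeAt A P I ports (T₁ + 1 + T₂) v) =
        some (P.offset k + (P.palette k + y v)) ∧ 1 ≤ y v ∧ y v ≤ P.palette k) ∧
      ∀ u ∈ contenders I ports P.palette k, ∀ v ∈ contenders I ports P.palette k,
        I.graph.Adj u v → y u ≠ y v := by
  obtain ⟨n, hn, htrial⟩ := htrial
  have hpair : ∀ v ∈ contenders I ports P.palette k,
      (nodeAt A P I ports (P.startTime (n + 1)) v).pair.isSome := by
    intro v hv
    obtain ⟨K, T, h, hK, hT⟩ := htrial (rivals A P I ports k (P.startTime n))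
      (rivals_subset A P I ports k _) (Finset.filter_subset _ _)
    exact pair_isSome_of_colorsWithin hports h hK hT hv
  set t₁ := P.startTime (n + 1) with ht₁
  obtain ⟨hbound, hprop⟩ := pairs_proper (A := A) (P := P) hports k (n + 1)
  have hex : ∀ v, ∃ c : ℕ, ∀ t q, (nodeAt A P I ports t v).pair = some q →
      v ∈ contenders I ports P.palette k →
      (nodeAt A P I ports t₁ v).pair = some q ∧ Nat.pair q.1 q.2 + 1 = c := by
    intro v
    by_cases hv : v ∈ contenders I ports P.palette k
    · obtain ⟨q, hq⟩ := Option.isSome_iff_exists.1 (hpair v hv)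
      refine ⟨Nat.pair q.1 q.2 + 1, fun t q' hq' _ => ?_⟩
      obtain rfl : q = q' := by
        rcases le_total t₁ t with h | h
        · exact Option.some.inj ((pair_nodeAt_of_le A P I ports h hq).symm.trans hq')
        · exact Option.some.inj (hq.symm.trans (pair_nodeAt_of_le A P I ports h hq'))
      exact ⟨hq, rfl⟩
    · exact ⟨0, fun t q _ h => absurd h hv⟩
  choose χ hχ using hex
  have hχ' : ∀ v ∈ contenders I ports P.palette k, ∃ q : ℕ × ℕ,
      (nodeAt A P I ports t₁ v).pair = some q ∧ χ v = Nat.pair q.1 q.2 + 1 := fun v hv => by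
    obtain ⟨q, hq⟩ := Option.isSome_iff_exists.1 (hpair v hv)
    exact ⟨q, hq, (hχ v t₁ q hq hv).2.symm⟩
  have hpos : ∀ v ∈ contenders I ports P.palette k, 0 < χ v := fun v hv => by
    obtain ⟨q, -, hq⟩ := hχ' v hv
    omega
  have hproper : ∀ u ∈ contenders I ports P.palette k, ∀ v ∈ contenders I ports P.palette k,
      I.graph.Adj u v → χ u ≠ χ v := by
    intro u hu v hv huv e
    obtain ⟨p, hp, hp'⟩ := hχ' u hu
    obtain ⟨q, hq, hq'⟩ := hχ' v hv
    rw [hp', hq', Nat.add_right_cancel_iff, Nat.pair_eq_pair] at e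
    exact hprop u hu v hv huv p hp (by rw [hq, Prod.ext e.1 e.2])
  obtain ⟨K, T, ⟨t₂, ht₂, y, hy1, hy2, hy3⟩, hK, hT⟩ := hfinal χ hpos hproper fun v hv => by
    obtain ⟨q, hq, e⟩ := hχ' v hv
    obtain ⟨h1, h2⟩ := hbound v hv q hq
    have h3 : (ports v).length ≤ 2 ^ k := by
      rw [← (mem_contenders.1 hv).2.1]
      exact Nat.le_pow_clog one_lt_two _
    have h4 := Nat.pair_lt_max_add_one_sq q.1 q.2
    have h5 : max q.1 q.2 ≤ P.palette k := max_le h1 (h2.trans (h3.trans (hpal k)))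
    have h6 : (max q.1 q.2 + 1) ^ 2 ≤ (P.palette k + 1) ^ 2 := by gcongr
    omega
  have hverts : ∀ v ∈ contenders I ports P.palette k,
      v ∈ (I.induce (contenders I ports P.palette k) χ hpos hproper).verts := fun v hv =>
    Finset.mem_inter.2 ⟨(mem_contenders.1 hv).1, hv⟩
  have htt : t₂ ≤ T₂ := by exact_mod_cast ht₂.trans hT
  refine ⟨y, fun v hv => ⟨?_, (hy2 v (hverts v hv)).1, ?_⟩, fun u hu v hv huv =>
    hy3 u v ⟨huv, hu, hv⟩⟩
  · have := nodeOut_of_colorsWithin hports hpair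
      (fun t v hv q hq => (hχ v t q hq hv).2) (fun v hv => hy1 v (hverts v hv)) hv
    have stay : nodeAt A P I ports (T₁ + 1 + T₂) v = nodeAt A P I ports (t₁ + 1 + t₂) v :=
      (coloringMachine A P).run_of_out I ports (Option.isSome_iff_exists.2 ⟨_, this⟩) (by omega)
    rw [stay, this]
  · have := (hy2 v (hverts v hv)).2.trans_lt hK
    exact Nat.lt_succ_iff.1 (by exact_mod_cast this)

/-- The layers use disjoint sets of colors, so that it suffices to color each layer properly. -/
theorem coloringMachine_colorsWithin (hports : IsPortNumbering I.toNetwork ports)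
    (hpal : ∀ k, 2 ^ k ≤ P.palette k) {T₁ T₂ : ℕ}
    (htrial : ∀ k, (contenders I ports P.palette k).Nonempty →
      ∃ n, P.startTime (n + 1) ≤ T₁ ∧ ∀ W (hW : W ⊆ I.verts),
      W ⊆ contenders I ports P.palette k → ∃ K T : ℝ,
        A.ColorsWithin (P.trialGuess k n) (I.restrict W hW) (portsIn ports W) K T ∧
        K < P.palette k + 1 ∧ T ≤ P.trialTime n)
    (hfinal : ∀ k, (contenders I ports P.palette k).Nonempty → ∀ χ hpos hproper,
      (∀ v ∈ contenders I ports P.palette k, χ v ≤ (P.palette k + 1) ^ 2) →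
      ∃ K T : ℝ, A.ColorsWithin (P.finalGuess k)
        (I.induce (contenders I ports P.palette k) χ hpos hproper)
        (portsIn ports (contenders I ports P.palette k)) K T ∧ K < P.palette k + 1 ∧ T ≤ T₂)
    {K T : ℝ} (hK : (P.offset (Nat.clog 2 (maxDegree I : ℕ) + 1) : ℝ) ≤ K)
    (hT : (T₁ + T₂ + 2 : ℕ) ≤ T) :
    (coloringMachine A P).toLocal.ColorsWithin () I ports K T := by
  have hlayer : ∀ k, ∃ y : ℕ → ℕ, (∀ v ∈ contenders I ports P.palette k,
      nodeOut A P (nodeAt A P I ports (T₁ + 1 + T₂) v) =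
        some (P.offset k + (P.palette k + y v)) ∧ 1 ≤ y v ∧ y v ≤ P.palette k) ∧
      ∀ u ∈ contenders I ports P.palette k, ∀ v ∈ contenders I ports P.palette k,
        I.graph.Adj u v → y u ≠ y v := by
    intro k
    by_cases h : (contenders I ports P.palette k).Nonempty
    · exact contenders_output hports hpal (htrial k h) (hfinal k h)
    · rw [Finset.not_nonempty_iff_eq_empty] at h
      exact ⟨0, by simp [h], by simp [h]⟩
  choose y hy hyp using hlayer
  -- the layer of a node, and its color within the range of that layer
  set L : ℕ → ℕ := fun v => Nat.clog 2 (ports v).length with hL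
  set z : ℕ → ℕ := fun v =>
    if I.color v ≤ P.palette (L v) then I.color v else P.palette (L v) + y (L v) v with hz
  have hcont : ∀ v ∈ I.verts, ¬ I.color v ≤ P.palette (L v) →
      v ∈ contenders I ports P.palette (L v) := fun v hv h =>
    mem_contenders.2 ⟨hv, rfl, not_le.1 h⟩
  have hz1 : ∀ v ∈ I.verts, 1 ≤ z v ∧ z v ≤ 2 * P.palette (L v) := by
    intro v hv
    simp only [hz]
    split_ifs with h
    · have := I.color_pos v hv
      omega
    · have := (hy _ v (hcont v hv h)).2
      omega
  have hout : ∀ v ∈ I.verts, nodeOut A P (nodeAt A P I ports (T₁ + 1 + T₂) v) =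
      some (P.offset (L v) + z v) := by
    intro v hv
    simp only [hz]
    split_ifs with h
    · exact nodeOut_of_small h
    · exact (hy _ v (hcont v hv h)).1
  refine ⟨T₁ + 1 + T₂ + 1, by rwa [show T₁ + 1 + T₂ + 1 = T₁ + T₂ + 2 by omega],
    fun v => P.offset (L v) + z v,
    fun v hv => (coloringMachine A P).toLocal_out I ports (hout v hv),
    fun v hv => ⟨(hz1 v hv).1.trans (Nat.le_add_left _ _), le_trans ?_ hK⟩, fun u v huv e => ?_⟩
  · have h1 : P.offset (L v) + z v ≤ P.offset (L v + 1) := by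
      rw [offset_succ]
      have := hz1 v hv
      omega
    refine Nat.cast_le.2 (h1.trans (offset_mono (Nat.succ_le_succ (Nat.clog_mono_right 2 ?_))))
    rw [length_ports hports hv]
    exact degree_le_maxDegree I hv
  · have hu := I.mem_of_adj u v huv
    have hv := I.mem_of_adj v u huv.symm
    simp only at e
    rcases lt_trichotomy (L u) (L v) with h | h | h
    · have h1 := offset_mono (P := P) (Nat.succ_le_of_lt h)
      rw [Nat.succ_eq_add_one, offset_succ] at h1
      have := hz1 u hu
      have := hz1 v hv
      omega
    · rw [h, Nat.add_left_cancel_iff] at e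
      simp only [hz, h] at e
      have hyu := hy (L u) u
      have hyv := hy (L v) v
      split_ifs at e with h1 h2 h2
      · exact I.color_proper u v huv e
      · have := hyv (hcont v hv h2)
        omega
      · have := hyu (hcont u hu (h ▸ h1))
        rw [h] at this
        omega
      · exact hyp (L v) u (h ▸ hcont u hu (h ▸ h1)) v (hcont v hv h2) huv (by omega)
    · have h1 := offset_mono (P := P) (Nat.succ_le_of_lt h)
      rw [Nat.succ_eq_add_one, offset_succ] at h1
      have := hz1 u hu
      have := hz1 v hv
      omega

end

/-! ### The schedule of the trials -/

theorem sum_getD_le {α : Type*} (w : α → ℕ) (d : α) (l : List α) {n : ℕ} (hn : n ≤ l.length) :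
    ∑ m ∈ Finset.range n, w (l.getD m d) ≤ (l.map w).sum := by
  induction l generalizing n with
  | nil => simp [Nat.le_zero.1 hn]
  | cons a l ih =>
    cases n with
    | zero => simp
    | succ n =>
      rw [Finset.sum_range_succ', List.map_cons, List.sum_cons, Nat.add_comm]
      have := ih (Nat.le_of_succ_le_succ hn)
      simpa using this

/-- Non-empty lists can be concatenated to a sequence in which every entry of the `j`-th list is
preceded by entries of the first `j` lists only. -/
theorem exists_concat {α : Type*} (w : α → ℕ) (E : ℕ → List α) (hE : ∀ j, E j ≠ []) :
    ∃ u : ℕ → α, ∀ j, ∀ e ∈ E j, ∃ n, u n = e ∧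
      ∑ m ∈ Finset.range (n + 1), w (u m) ≤ ∑ i ∈ Finset.range (j + 1), ((E i).map w).sum := by
  set L : ℕ → List α := fun j => (List.range j).flatMap E with hL
  have hsucc : ∀ j, L (j + 1) = L j ++ E j := fun j => by
    simp [hL, List.range_succ, List.flatMap_append]
  have hlen : ∀ j, j ≤ (L j).length := by
    intro j
    induction j with
    | zero => exact Nat.zero_le _
    | succ j ih =>
      rw [hsucc, List.length_append]
      have := List.length_pos_of_ne_nil (hE j)
      omega
  have hpre : ∀ i j, i ≤ j → L i <+: L j := by
    intro i j h
    induction j, h using Nat.le_induction with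
    | base => exact List.prefix_refl _
    | succ j _ ih => exact ih.trans (hsucc j ▸ List.prefix_append _ _)
  have hsum : ∀ j, ((L j).map w).sum = ∑ i ∈ Finset.range j, ((E i).map w).sum := by
    intro j
    induction j with
    | zero => rfl
    | succ j ih => rw [hsucc, List.map_append, List.sum_append, ih, Finset.sum_range_succ]
  obtain ⟨d, -⟩ := List.exists_mem_of_ne_nil _ (hE 0)
  have hget : ∀ i j n, n < (L i).length → n < (L j).length → (L i).getD n d = (L j).getD n d := by
    have : ∀ i j n, i ≤ j → n < (L i).length → (L i).getD n d = (L j).getD n d := by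
      intro i j n h hn
      obtain ⟨t, ht⟩ := hpre i j h
      rw [← ht, List.getD_append _ _ _ _ hn]
    intro i j n hi hj
    rcases le_total i j with h | h
    · exact this i j n h hi
    · exact (this j i n h hj).symm
  refine ⟨fun n => (L (n + 1)).getD n d, fun j e he => ?_⟩
  have he' : e ∈ L (j + 1) := by rw [hsucc]; exact List.mem_append_right _ he
  obtain ⟨n, hn, hne⟩ := List.mem_iff_getElem.1 he'
  refine ⟨n, ?_, ?_⟩
  · simp only
    rw [hget (n + 1) (j + 1) n (hlen _) hn, List.getD_eq_getElem _ _ hn, hne]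
  · rw [← hsum]
    refine le_trans (le_of_eq ?_) (sum_getD_le w d _ (Nat.succ_le_of_lt hn))
    refine Finset.sum_congr rfl fun m hm => ?_
    have := Finset.mem_range.1 hm
    simp only
    rw [hget (m + 1) (j + 1) m (hlen _) (by omega)]

theorem moderatelySlow_pow_mul {s : ℕ+ → ℕ} (hs : ModeratelySlow fun i => (s i : ℝ)) (b : ℕ) :
    ∃ C : ℝ, 0 < C ∧ ∀ i : ℕ+, 1 ≤ s i → (s (2 ^ b * i) : ℝ) ≤ C * s i := by
  obtain ⟨α, -, h⟩ := hs
  have key : ∀ i : ℕ+, i ≠ 1 → (s (2 ^ b * i) : ℝ) ≤ (α : ℕ) ^ b * s i := by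
    intro i hi
    induction b with
    | zero => simp
    | succ b ih =>
      have hne : 2 ^ b * i ≠ 1 := fun e => hi (PNat.dvd_one_iff i |>.1 (e ▸ dvd_mul_left i _))
      calc (s (2 ^ (b + 1) * i) : ℝ) = s (2 * (2 ^ b * i)) := by rw [pow_succ', mul_assoc]
        _ ≤ (α : ℕ) * s (2 ^ b * i) := h _ hne
        _ ≤ (α : ℕ) * ((α : ℕ) ^ b * s i) := by gcongr
        _ = (α : ℕ) ^ (b + 1) * s i := by ring
  refine ⟨(α : ℕ) ^ b + s (2 ^ b), ?_, fun i hi => ?_⟩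
  · have : (0 : ℝ) < (α : ℕ) := by exact_mod_cast α.pos
    positivity
  · have hi' : (1 : ℝ) ≤ s i := by exact_mod_cast hi
    rw [add_mul]
    by_cases h1 : i = 1
    · subst h1
      rw [mul_one]
      have : (s (2 ^ b) : ℝ) ≤ s (2 ^ b) * s 1 := le_mul_of_one_le_right (Nat.cast_nonneg _) hi'
      have : (0 : ℝ) ≤ (α : ℕ) ^ b * s 1 := by positivity
      linarith
    · have := key i h1
      have : (0 : ℝ) ≤ s (2 ^ b) * s i := by positivity
      linarith

section

variable {ι : Type} {f : (ι → ℕ+) → ℝ} {s : ℕ+ → ℕ}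

theorem one_le_sequenceNumber (hs : IsSequenceNumberFunction f s) {y : ι → ℕ+} {i : ℕ+}
    (h : f y ≤ (i : ℕ)) : 1 ≤ s i := by
  obtain ⟨-, S, c, -, hS⟩ := hs
  obtain ⟨x, hx, -⟩ := (hS i).1 y h
  exact (Finset.card_pos.2 ⟨x, hx⟩).trans_le (hS i).2.2

theorem le_toPNat'_ceil {r : ℝ} (hr : 0 < r) : r ≤ (Nat.toPNat' ⌈r⌉₊ : ℕ) := by
  rw [Nat.toPNat'_coe, if_pos (Nat.ceil_pos.2 hr)]
  exact Nat.le_ceil r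

/-- The guess vectors of the bounded set-sequence of `f` at the indices `1, 2, 4, …` are tried one
after the other, those at the index `i` for about `c * i` rounds.  As the lengths of the phases
grow geometrically, the total time is dominated by the phase in which a good vector occurs. -/
theorem exists_schedule (hfpos : ∀ x, 0 < f x) (hfmono : Monotone f)
    (hs : IsSequenceNumberFunction f s) {β : ℝ} (hβ : 0 < β) :
    ∃ (x : ℕ → ι → ℕ+) (τ : ℕ → ℕ) (C : ℝ), 0 < C ∧ ∀ w y, f y ≤ β * f w →
      ∃ n, y ≤ x n ∧ f (x n) ≤ τ n ∧
        ((∑ m ∈ Finset.range (n + 1), (τ m + 2) : ℕ) : ℝ) ≤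
          C * (f w * s (Nat.toPNat' ⌈f w⌉₊)) := by
  have hs' := hs
  obtain ⟨hslow, S, c, hc, hS⟩ := hs'
  have hsmono : Monotone s := fun i j h => by
    obtain ⟨_, hmono, _⟩ := hslow
    exact Nat.cast_le.1 (hmono h)
  -- the dummy entry makes sure that no phase is empty
  obtain ⟨u, hu⟩ := exists_concat (fun e : (ι → ℕ+) × ℕ => e.2 + 2)
    (fun j => (1, 0) :: (S (2 ^ j)).toList.map fun x => (x, ⌈c * 2 ^ j⌉₊)) (fun j => by simp)
  have hf1 : 0 < f 1 := hfpos 1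
  set B : ℝ := 2 * β + 1 / f 1 with hB
  have hB0 : 0 < B := by positivity
  obtain ⟨b, hb⟩ : ∃ b : ℕ, B ≤ 2 ^ b := by
    obtain ⟨b, hb⟩ := pow_unbounded_of_one_lt B one_lt_two
    exact ⟨b, hb.le⟩
  obtain ⟨Cs, hCs, hslow'⟩ := moderatelySlow_pow_mul hslow b
  refine ⟨fun n => (u n).1, fun n => (u n).2, Cs * (c + 5) * (2 * B), by positivity,
    fun w y hyw => ?_⟩
  have hw : f 1 ≤ f w := hfmono fun _ => one_le
  have hy1 : f 1 ≤ f y := hfmono fun _ => one_le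
  have hex : ∃ J : ℕ, f y ≤ 2 ^ J := by
    obtain ⟨J, hJ⟩ := pow_unbounded_of_one_lt (f y) one_lt_two
    exact ⟨J, hJ.le⟩
  classical
  set J := Nat.find hex with hJ
  have hJy : f y ≤ 2 ^ J := Nat.find_spec hex
  have hJle : (2 : ℝ) ^ J ≤ B * f w := by
    have h1 : 1 ≤ 1 / f 1 * f w := by
      rw [one_div, inv_mul_eq_div, one_le_div hf1]
      exact hw
    rcases Nat.eq_zero_or_pos J with h | h
    · have : 0 ≤ β * f w := (hfpos y).le.trans hyw
      rw [h, pow_zero, hB]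
      linarith
    · have h2 := Nat.find_min hex (Nat.sub_lt h one_pos)
      rw [not_le, ← hJ] at h2
      have h3 : (2 : ℝ) ^ J = 2 * 2 ^ (J - 1) := by
        rw [← pow_succ', Nat.sub_add_cancel h]
      rw [hB, h3]
      linarith
  have hcast : ∀ i : ℕ, (((2 ^ i : ℕ+) : ℕ) : ℝ) = 2 ^ i := fun i => by push_cast; rfl
  obtain ⟨x, hx, hyx⟩ := (hS (2 ^ J)).1 y (by rwa [hcast])
  obtain ⟨n, hn, hsum⟩ := hu J (x, ⌈c * 2 ^ J⌉₊)
    (List.mem_cons_of_mem _ (List.mem_map.2 ⟨x, Finset.mem_toList.2 hx, rfl⟩))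
  refine ⟨n, by simpa only [hn] using hyx, ?_, ?_⟩
  · simp only [hn]
    have := (hS (2 ^ J)).2.1 x hx
    rw [hcast] at this
    exact this.trans (Nat.le_ceil _)
  · set i := Nat.toPNat' ⌈f w⌉₊ with hi
    have hwi : f w ≤ (i : ℕ) := le_toPNat'_ceil (hfpos w)
    have hsi : 1 ≤ s i := one_le_sequenceNumber hs hwi
    have hJi : (2 : ℕ+) ^ J ≤ 2 ^ b * i := by
      rw [← PNat.coe_le_coe, ← Nat.cast_le (α := ℝ), hcast, PNat.mul_coe, Nat.cast_mul, hcast]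
      calc (2 : ℝ) ^ J ≤ B * f w := hJle
        _ ≤ 2 ^ b * (i : ℕ) := by
            have := (hfpos w).le
            gcongr
    have hσ : (s (2 ^ J) : ℝ) ≤ Cs * s i :=
      (Nat.cast_le.2 (hsmono hJi)).trans (hslow' i hsi)
    have hσ1 : (1 : ℝ) ≤ s (2 ^ J) := by
      exact_mod_cast one_le_sequenceNumber hs (y := y) (by rwa [hcast])
    have hphase : ∀ j ∈ Finset.range (J + 1),
        (((((1, 0) :: (S (2 ^ j)).toList.map fun x => (x, ⌈c * 2 ^ j⌉₊)).map
          fun e : (ι → ℕ+) × ℕ => e.2 + 2).sum : ℕ) : ℝ) ≤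
          s (2 ^ J) * (c + 5) * 2 ^ j := by
      intro j hj
      have hjJ : j ≤ J := Nat.lt_succ_iff.1 (Finset.mem_range.1 hj)
      have h1 : ((S (2 ^ j)).card : ℝ) ≤ s (2 ^ J) := by
        exact_mod_cast (hS (2 ^ j)).2.2.trans (hsmono (pow_le_pow_right' one_le hjJ))
      have h2 : (⌈c * 2 ^ j⌉₊ : ℝ) ≤ c * 2 ^ j + 1 := (Nat.ceil_lt_add_one (by positivity)).le
      have h3 : (1 : ℝ) ≤ 2 ^ j := one_le_pow₀ one_le_two
      have h4 : ((((1, 0) :: (S (2 ^ j)).toList.map fun x => (x, ⌈c * 2 ^ j⌉₊)).map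
          fun e : (ι → ℕ+) × ℕ => e.2 + 2).sum : ℕ) =
          2 + (S (2 ^ j)).card * (⌈c * 2 ^ j⌉₊ + 2) := by
        rw [List.map_cons, List.sum_cons, List.map_map]
        congr 1
        rw [show ((fun e : (ι → ℕ+) × ℕ => e.2 + 2) ∘ fun x => (x, ⌈c * 2 ^ j⌉₊)) =
          fun _ => ⌈c * 2 ^ j⌉₊ + 2 from rfl, List.map_const', List.sum_replicate,
          Finset.length_toList, smul_eq_mul]
      rw [h4]
      push_cast
      calc (2 : ℝ) + (S (2 ^ j)).card * (⌈c * 2 ^ j⌉₊ + 2)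
          ≤ s (2 ^ J) * (2 * 2 ^ j) + s (2 ^ J) * (c * 2 ^ j + 1 + 2) := by
            gcongr
            nlinarith
        _ ≤ s (2 ^ J) * (2 * 2 ^ j) + s (2 ^ J) * ((c + 3) * 2 ^ j) := by
            gcongr
            linarith
        _ = s (2 ^ J) * (c + 5) * 2 ^ j := by ring
    calc ((∑ m ∈ Finset.range (n + 1), ((u m).2 + 2) : ℕ) : ℝ)
        ≤ ((∑ j ∈ Finset.range (J + 1),
          (((1, 0) :: (S (2 ^ j)).toList.map fun x => (x, ⌈c * 2 ^ j⌉₊)).map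
            fun e : (ι → ℕ+) × ℕ => e.2 + 2).sum : ℕ) : ℝ) := Nat.cast_le.2 hsum
      _ ≤ ∑ j ∈ Finset.range (J + 1), s (2 ^ J) * (c + 5) * 2 ^ j := by
          rw [Nat.cast_sum]
          exact Finset.sum_le_sum hphase
      _ = s (2 ^ J) * (c + 5) * (2 ^ (J + 1) - 1) := by
          rw [← Finset.mul_sum, geom_sum_eq (by norm_num)]
          norm_num
      _ ≤ Cs * s i * (c + 5) * (2 * (B * f w)) := by
          have h0 : (0 : ℝ) ≤ 2 ^ (J + 1) - 1 := sub_nonneg.2 (one_le_pow₀ one_le_two)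
          have h1 : (2 : ℝ) ^ (J + 1) - 1 ≤ 2 * (B * f w) := by rw [pow_succ']; linarith
          gcongr
      _ = Cs * (c + 5) * (2 * B) * (f w * s i) := by ring

end

/-! ### The number of colors -/

theorem sum_le_of_doubling {G : ℕ → ℝ} (hmono : Monotone G) (hpos : ∀ k, 0 ≤ G k) {a : ℕ}
    (ha : 0 < a) (h : ∀ k, k ≠ 0 → 2 * G k ≤ G (k + a)) (n : ℕ) :
    ∑ j ∈ Finset.range (n + 1), G j ≤ (2 * a + 2) * G n := by
  induction n using Nat.strong_induction_on with
  | _ n ih =>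
    rcases le_or_gt n a with hn | hn
    · calc ∑ j ∈ Finset.range (n + 1), G j ≤ ∑ j ∈ Finset.range (n + 1), G n :=
            Finset.sum_le_sum fun j hj => hmono (Nat.lt_succ_iff.1 (Finset.mem_range.1 hj))
        _ = (n + 1) * G n := by simp
        _ ≤ (2 * a + 2) * G n := by
            have : (n : ℝ) ≤ a := Nat.cast_le.2 hn
            have := hpos n
            have : (0 : ℝ) ≤ a := Nat.cast_nonneg a
            exact mul_le_mul_of_nonneg_right (by linarith) ‹_›
    · obtain ⟨m, rfl⟩ := Nat.exists_eq_add_of_le' hn.le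
      have h1 := ih m (by omega)
      have h2 : ∑ j ∈ Finset.range a, G (m + 1 + j) ≤ a * G (m + a) := by
        calc _ ≤ ∑ j ∈ Finset.range a, G (m + a) := Finset.sum_le_sum fun j hj =>
              hmono (by have := Finset.mem_range.1 hj; omega)
          _ = _ := by simp
      rw [show m + a + 1 = m + 1 + a by omega, Finset.sum_range_add]
      have h3 := h m (by omega)
      have h4 := hpos (m + a)
      have h5 : (2 * (a : ℝ) + 2) * G m ≤ (a + 1) * G (m + a) := by
        calc (2 * (a : ℝ) + 2) * G m = (a + 1) * (2 * G m) := by ring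
          _ ≤ _ := by gcongr
      linarith

/-- The palettes of the layers up to the layer of the degree `d` have together a size of at most
`O(g d)`. -/
theorem palette_sum_le {g : ℝ → ℝ} (hg : ModeratelyFast g) :
    ∃ C : ℝ, 0 < C ∧ ∀ d : ℕ+,
      ((∑ j ∈ Finset.range (Nat.clog 2 d + 1), 2 * ⌊g (2 ^ j)⌋₊ : ℕ) : ℝ) ≤ C * g (d : ℕ) := by
  obtain ⟨⟨hmono, α, hα⟩, Q, hP⟩ := hg
  have hα1 : (1 : ℝ) ≤ (α : ℕ) := by exact_mod_cast α.pos
  have hpos : ∀ x : ℝ, 0 < x → 0 ≤ g x := fun x hx => hx.le.trans (hP x hx).1.le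
  have hmono' : ∀ x y : ℝ, 0 < x → x ≤ y → g x ≤ g y := fun x y hx hxy =>
    hmono hx (hx.trans_le hxy) hxy
  have hcast : ∀ i : ℕ, (((2 ^ i : ℕ+) : ℕ) : ℝ) = 2 ^ i := fun i => by push_cast; rfl
  have hsum := sum_le_of_doubling (G := fun k => g (2 ^ k)) (a := (α : ℕ))
    (fun i j h => hmono' _ _ (by positivity) (pow_le_pow_right₀ one_le_two h))
    (fun k => hpos _ (by positivity)) α.pos (fun k hk => by
      have h1 := (hα (2 ^ k) (fun e => by
        have e' := congrArg PNat.val e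
        rw [PNat.val_ofNat] at e'
        have : (2 : ℕ) ^ k = 1 := by simpa using e'
        exact hk (by simpa using this))).1
      rw [hcast, PNat.mul_coe, Nat.cast_mul, hcast] at h1
      refine h1.trans (hmono' _ _ (by positivity) ?_)
      rw [pow_add, mul_comm]
      gcongr
      exact_mod_cast Nat.lt_two_pow_self.le)
  refine ⟨2 * (2 * (α : ℕ) + 2) * (α : ℕ), by positivity, fun d => ?_⟩
  have hd : g (2 ^ Nat.clog 2 d) ≤ (α : ℕ) * g (d : ℕ) := by
    by_cases h1 : d = 1
    · subst h1
      have := hpos 1 one_pos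
      simp only [PNat.one_coe, Nat.clog_one_right, pow_zero, Nat.cast_one]
      nlinarith
    · refine le_trans (hmono' _ _ (by positivity) ?_) (hα d h1).2
      have h2 : 1 < (d : ℕ) := by
        rcases Nat.lt_or_ge 1 (d : ℕ) with h | h
        · exact h
        · exact absurd (PNat.coe_eq_one_iff.1 (le_antisymm h d.pos)) h1
      have h3 := Nat.pow_pred_clog_lt_self one_lt_two h2
      have h4 := Nat.clog_pos one_lt_two h2
      have h5 : 2 ^ Nat.clog 2 d ≤ 2 * (d : ℕ) := by
        rw [← Nat.succ_pred_eq_of_pos h4, pow_succ']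
        omega
      rw [PNat.mul_coe]
      exact_mod_cast h5
  push_cast
  calc ∑ j ∈ Finset.range (Nat.clog 2 d + 1), 2 * (⌊g (2 ^ j)⌋₊ : ℝ)
      ≤ ∑ j ∈ Finset.range (Nat.clog 2 d + 1), 2 * g (2 ^ j) :=
        Finset.sum_le_sum fun j _ => by
          have := Nat.floor_le (hpos (2 ^ j) (by positivity))
          linarith
    _ = 2 * ∑ j ∈ Finset.range (Nat.clog 2 d + 1), g (2 ^ j) := by rw [Finset.mul_sum]
    _ ≤ 2 * ((2 * (α : ℕ) + 2) * ((α : ℕ) * g (d : ℕ))) := by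
        have := hsum (Nat.clog 2 d)
        have : (2 * ((α : ℕ) : ℝ) + 2) * g (2 ^ Nat.clog 2 d) ≤
          (2 * (α : ℕ) + 2) * ((α : ℕ) * g (d : ℕ)) := by gcongr
        linarith
    _ = _ := by ring

/-! ### Guesses and the growth of the running time -/

/-- A vector of guesses that is good for the parameters in `Λ` yields a good guess for each
parameter that belongs to `Λ` or is weakly dominated by `Λ`. -/
theorem exists_guess {𝒢 : Set Network} {Γ Λ : Finset Parameter} (h : WeaklyDominated 𝒢 Γ Λ)
    {p : Parameter} (hp : p ∈ Γ) :
    ∃ F : (Λ → ℕ+) → ℕ+, (∀ h : p ∈ Λ, ∀ x, F x = x ⟨p, h⟩) ∧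
      ∀ I : Instance, I.toNetwork ∈ 𝒢 → ∀ x : Λ → ℕ+, (∀ q : Λ, q.1 I ≤ x q) → p I ≤ F x := by
  by_cases hpΛ : p ∈ Λ
  · exact ⟨fun x => x ⟨p, hpΛ⟩, fun _ _ => rfl, fun I _ x hx => hx ⟨p, hpΛ⟩⟩
  obtain ⟨q, hq, u, ⟨-, hu⟩, hle⟩ := h p hp hpΛ
  have hex : ∀ x : Λ → ℕ+, ∃ N : ℕ+, ∀ n : ℕ+, u (n : ℕ) ≤ (x ⟨q, hq⟩ : ℕ) → n ≤ N := by
    intro x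
    obtain ⟨r, hr⟩ := Filter.eventually_atTop.1
      (hu.eventually_gt_atTop (((x ⟨q, hq⟩ : ℕ+) : ℕ) : ℝ))
    refine ⟨⟨⌈r⌉₊ + 1, Nat.succ_pos _⟩, fun n hn => ?_⟩
    by_contra hlt
    have hlt : ⌈r⌉₊ + 1 < (n : ℕ) := PNat.coe_lt_coe _ _ |>.2 (not_le.1 hlt)
    refine absurd (hr (n : ℕ) ((Nat.le_ceil r).trans ?_)) (not_lt.2 hn)
    exact_mod_cast (Nat.le_succ _).trans hlt.le
  choose F hF using hex
  refine ⟨F, fun h => absurd h hpΛ, fun I hI x hx => hF x _ ((hle I hI).trans ?_)⟩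
  exact_mod_cast hx ⟨q, hq⟩

open Classical in
/-- The vector `w` with the value of the parameter `p`, if it occurs, raised to at least `d`. -/
noncomputable def raise {Λ : Finset Parameter} (p : Parameter) (d : ℕ+) (w : Λ → ℕ+) : Λ → ℕ+ :=
  fun q => if q.1 = p then max (w q) d else w q

section

variable {Λ : Finset Parameter} {f : (Λ → ℕ+) → ℝ}

theorem le_raise (p : Parameter) (d : ℕ+) (w : Λ → ℕ+) : w ≤ raise p d w := by
  intro q
  rw [raise]
  split_ifs
  · exact le_max_left _ _
  · exact le_rfl

theorem le_raise_self {p : Parameter} {d : ℕ+} {w : Λ → ℕ+} {q : Λ} (h : q.1 = p) :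
    d ≤ raise p d w q := by
  rw [raise, if_pos h]
  exact le_max_right _ _

theorem raise_of_notMem {p : Parameter} (h : p ∉ Λ) (d : ℕ+) (w : Λ → ℕ+) : raise p d w = w := by
  funext q
  rw [raise, if_neg fun e : q.1 = p => h (e ▸ q.2)]

theorem raise_of_mem (inst : DecidableEq Λ) {p : Parameter} (h : p ∈ Λ) (d : ℕ+) (w : Λ → ℕ+) :
    raise p d w = Function.update w ⟨p, h⟩ (max (w ⟨p, h⟩) d) := by
  funext q
  by_cases e : q.1 = p
  · obtain rfl : q = ⟨p, h⟩ := Subtype.ext e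
    rw [raise, if_pos rfl, Function.update_self]
  · rw [raise, if_neg e, Function.update_of_ne fun e' => e (congrArg Subtype.val e')]

theorem update_value (inst : DecidableEq Λ) (q : Λ) (w : Λ → ℕ+) :
    Function.update w q (w q) = w := Function.update_eq_self q w

theorem raise_maxDegree_le (hfpos : ∀ x, 0 < f x)
    (hΔ : ∀ h : maxDegree ∈ Λ, DependsModeratelySlowly f ⟨maxDegree, h⟩) :
    ∃ α : ℝ, 0 < α ∧ ∀ (w : Λ → ℕ+) (d : ℕ+),
      (∀ h : maxDegree ∈ Λ, d = 1 ∨ w ⟨maxDegree, h⟩ ≠ 1 ∧ d ≤ 2 * w ⟨maxDegree, h⟩) →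
      f (raise maxDegree d w) ≤ α * f w := by
  by_cases h : maxDegree ∈ Λ
  · obtain ⟨α, hα⟩ := hΔ h
    have hα1 : (1 : ℝ) ≤ (α : ℕ) := by exact_mod_cast α.pos
    refine ⟨(α : ℕ), by linarith, fun w d hd => ?_⟩
    rcases hd h with rfl | ⟨h1, h2⟩
    · have : raise maxDegree 1 w = w := by
        classical
        rw [raise_of_mem inferInstance h, max_eq_left one_le, Function.update_eq_self]
      rw [this]
      exact le_mul_of_one_le_left (hfpos w).le hα1
    · have h3 : w ⟨maxDegree, h⟩ ≤ 2 * w ⟨maxDegree, h⟩ := le_mul_of_one_le_left' one_le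
      have h4 := (hα w).1 (max_le h3 h2)
      have h5 := (hα w).2 _ h1
      refine (congrArg f (raise_of_mem _ h d w)).le.trans (h4.trans (h5.trans_eq ?_))
      exact congrArg (fun z => ((α : ℕ) : ℝ) * f z) (update_value _ _ w)
  · refine ⟨1, one_pos, fun w d _ => ?_⟩
    rw [raise_of_notMem h, one_mul]

theorem raise_maxColor_le (hfpos : ∀ x, 0 < f x)
    (hm : ∀ h : maxColor ∈ Λ, DependsPolylogarithmically f ⟨maxColor, h⟩) :
    ∃ α : ℝ, 0 < α ∧ ∀ (w : Λ → ℕ+) (d : ℕ+), 2 ≤ d →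
      (∀ h : maxColor ∈ Λ, d ≤ w ⟨maxColor, h⟩) →
      f (raise maxColor (d ^ 2) w) ≤ α * f w := by
  by_cases h : maxColor ∈ Λ
  · obtain ⟨k, C, hC⟩ := hm h
    refine ⟨|C| * 2 ^ k + 1, by positivity, fun w d hd hdw => ?_⟩
    set a := w ⟨maxColor, h⟩ with ha
    have h2a : 2 ≤ a := hd.trans (hdw h)
    have h1 : f (raise maxColor (d ^ 2) w) ≤
        C * (Real.log ((max a (d ^ 2) : ℕ+) : ℕ) / Real.log (a : ℕ)) ^ k * f w := by
      refine (congrArg f (raise_of_mem _ h _ w)).le.trans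
        ((hC w a (max a (d ^ 2)) h2a (le_max_left _ _)).trans_eq ?_)
      exact congrArg (fun z => _ * f z) (update_value _ _ w)
    have ha1 : (1 : ℝ) < (a : ℕ) := by exact_mod_cast h2a
    have hlog : 0 < Real.log (a : ℕ) := Real.log_pos ha1
    have hmax : (((max a (d ^ 2) : ℕ+) : ℕ) : ℝ) ≤ ((a : ℕ) : ℝ) ^ 2 := by
      have : max a (d ^ 2) ≤ a ^ 2 := by
        refine max_le ?_ (pow_le_pow_left' (hdw h) 2)
        rw [sq]
        exact le_mul_of_one_le_left' one_le
      exact_mod_cast this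
    have hle : Real.log ((max a (d ^ 2) : ℕ+) : ℕ) / Real.log (a : ℕ) ≤ 2 := by
      rw [div_le_iff₀ hlog]
      calc _ ≤ Real.log (((a : ℕ) : ℝ) ^ 2) :=
            Real.log_le_log (by exact_mod_cast PNat.pos _) hmax
        _ = _ := by rw [Real.log_pow]; norm_num
    have h0 : 0 ≤ Real.log ((max a (d ^ 2) : ℕ+) : ℕ) / Real.log (a : ℕ) :=
      div_nonneg (Real.log_natCast_nonneg _) hlog.le
    have hw := hfpos w
    have h3 : C * (Real.log ((max a (d ^ 2) : ℕ+) : ℕ) / Real.log (a : ℕ)) ^ k * f w ≤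
        |C| * 2 ^ k * f w := by
      gcongr
      exact le_abs_self C
    linarith
  · refine ⟨1, one_pos, fun w d _ _ => ?_⟩
    rw [raise_of_notMem h, one_mul]

end

theorem IsGraphParameter.induce_le {𝒢 : Set Network} (h𝒢 : ClosedUnderInclusion 𝒢)
    {q : Parameter} (hq : IsGraphParameter 𝒢 q) (hmono : NonDecreasing 𝒢 q) {I : Instance}
    (hI : I.toNetwork ∈ 𝒢) {W : Finset ℕ} (hW : W ⊆ I.verts) (χ : ℕ → ℕ) (hpos) (hproper) :
    q (I.induce W χ hpos hproper) ≤ q I := by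
  have hsub : (I.restrict W hW).IsSub I := ⟨I.induce_isSub W _ _ _, fun _ _ => rfl⟩
  exact (hq (I.restrict W hW) (I.induce W χ hpos hproper) (h𝒢 _ hI _ hsub.1) rfl).symm.le.trans
    (hmono I _ hI hsub)

/-- A run of `A` on a sub-instance with nodes of bounded degree, in terms of an upper bound for
the guesses and for the true values of the other parameters. -/
theorem IsColoringAlgorithm.colorsWithin {𝒢 : Set Network} {Γ Λ : Finset Parameter}
    {A : LocalAlgorithm (Guesses Γ)} {g : ℝ → ℝ} {f : (Λ → ℕ+) → ℝ}
    (hA : IsColoringAlgorithm 𝒢 Γ Λ A g f) (hfmono : Monotone f)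
    (hg : MonotoneOn g (Set.Ioi 0)) {J : Instance} (hJ : J.toNetwork ∈ 𝒢) {ports : ℕ → List ℕ}
    (hports : IsPortNumbering J.toNetwork ports) {a : Guesses Γ} (ha : Good a J) {D : ℕ+}
    (hD : maxDegree J ≤ D) (haD : ∀ p : Γ, p.1 = maxDegree → a p = D) {x : Λ → ℕ+}
    (hx : ∀ q : Λ, ∀ h : q.1 ∈ Γ, a ⟨q.1, h⟩ ≤ x q)
    (hx' : ∀ q : Λ, q.1 ∉ Γ → q.1 J ≤ x q) :
    ∃ K T : ℝ, A.ColorsWithin a J ports K T ∧ K ≤ g (D : ℕ) ∧ T ≤ f x := by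
  refine ⟨_, _, hA J hJ ports hports a ha, hg ?_ ?_ ?_, hfmono fun q => ?_⟩
  · exact Nat.cast_pos (α := ℝ).2 (PNat.pos _)
  · exact Nat.cast_pos (α := ℝ).2 (PNat.pos _)
  · refine Nat.cast_le.2 (PNat.coe_le_coe _ _ |>.2 ?_)
    rw [guessOrTrue]
    split_ifs with h
    · exact (haD ⟨_, h⟩ rfl).le
    · exact hD
  · rw [guessOrTrue]
    split_ifs with h
    · exact hx q h
    · exact hx' q h

/-! ### The uniform algorithm -/

theorem contender_bounds {I : Instance} {ports : ℕ → List ℕ}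
    (hports : IsPortNumbering I.toNetwork ports) {K : ℕ → ℕ} {k v : ℕ}
    (hv : v ∈ contenders I ports K k) :
    I.degree v ≤ 2 ^ k ∧ K k < (maxColor I : ℕ) ∧
      ((2 : ℕ+) ^ k = 1 ∨ maxDegree I ≠ 1 ∧ 2 ^ k ≤ 2 * maxDegree I) := by
  obtain ⟨h1, h2, h3⟩ := mem_contenders.1 hv
  rw [length_ports hports h1] at h2
  refine ⟨h2 ▸ Nat.le_pow_clog one_lt_two _, h3.trans_le (color_le_maxColor I h1), ?_⟩
  rcases Nat.eq_zero_or_pos k with rfl | hk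
  · exact Or.inl (pow_zero _)
  have hd : 1 < I.degree v := by
    by_contra h
    rw [Nat.clog_of_right_le_one (not_lt.1 h)] at h2
    omega
  have hΔ := degree_le_maxDegree I h1
  refine Or.inr ⟨fun e => ?_, ?_⟩
  · rw [e, PNat.one_coe] at hΔ
    omega
  · have h4 := Nat.pow_pred_clog_lt_self one_lt_two hd
    rw [h2] at h4
    rw [← PNat.coe_le_coe, PNat.pow_coe, PNat.mul_coe]
    have h5 : 2 ^ k = 2 * 2 ^ k.pred := by
      rw [← pow_succ', ← Nat.succ_eq_add_one, Nat.succ_pred_eq_of_pos hk]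
    change 2 ^ k ≤ 2 * _
    omega

theorem theorem5
    (𝒢 : Set Network) (h𝒢 : ClosedUnderInclusion 𝒢)
    (Γ Λ : Finset Parameter)
    (hΓ : ∀ p ∈ Γ, p = maxDegree ∨ p = maxColor)
    (hΛ : ∀ q ∈ Λ, q = maxColor ∨ IsGraphParameter 𝒢 q)
    (hΛmono : ∀ q ∈ Λ, NonDecreasing 𝒢 q)
    (hΓΛ : WeaklyDominated 𝒢 Γ Λ)
    (f : (Λ → ℕ+) → ℝ) (hfpos : ∀ x, 0 < f x) (hfmono : Monotone f)
    (g : ℝ → ℝ) (hg : ModeratelyFast g)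
    (A : LocalAlgorithm (Guesses Γ)) (hA : IsColoringAlgorithm 𝒢 Γ Λ A g f)
    (s : ℕ+ → ℕ) (hs : IsSequenceNumberFunction f s)
    (hm : ∀ h : maxColor ∈ Λ, DependsPolylogarithmically f ⟨maxColor, h⟩)
    (hΔ : ∀ h : maxDegree ∈ Λ, DependsModeratelySlowly f ⟨maxDegree, h⟩) :
    ∃ (U : LocalAlgorithm Unit) (C : ℝ),
      ∀ I : Instance, I.toNetwork ∈ 𝒢 →
        ∀ ports : ℕ → List ℕ, IsPortNumbering I.toNetwork ports →
          U.ColorsWithin () I ports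
            (C * g (maxDegree I : ℕ))
            (C * (f (fun q => q.1 I) *
              s (Nat.toPNat' ⌈f (fun q => q.1 I)⌉₊))) := by
  obtain ⟨Cg, hCg, hpalette⟩ := palette_sum_le hg
  obtain ⟨⟨hgmono, -⟩, Q, hgQ⟩ := hg
  obtain ⟨α, hα, hraiseΔ⟩ := raise_maxDegree_le hfpos hΔ
  obtain ⟨γ, hγ, hraisem⟩ := raise_maxColor_le hfpos hm
  obtain ⟨x, τ, C₁, hC₁, hsched⟩ := exists_schedule hfpos hfmono hs hα
  choose F hFΛ hF using fun p : Γ => exists_guess hΓΛ p.2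
  classical
  let K : ℕ → ℕ := fun k => ⌊g (2 ^ k)⌋₊
  let M : ℕ → ℕ+ := fun k => (K k).succPNat ^ 2
  let P : Plan (Guesses Γ) :=
    { palette := K
      trialGuess := fun k n p => if p.1 = maxDegree then 2 ^ k else F p (x n)
      trialTime := τ
      finalGuess := fun k p => if p.1 = maxDegree then 2 ^ k else M k }
  have hcast : ∀ i : ℕ, (((2 ^ i : ℕ+) : ℕ) : ℝ) = 2 ^ i := fun i => by push_cast; rfl
  have hpal : ∀ k, 2 ^ k ≤ K k := fun k => Nat.le_floor (by
    have := (hgQ (2 ^ k) (by positivity)).1.le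
    exact_mod_cast this)
  have hgK : ∀ k, ∀ r : ℝ, r ≤ g ((2 ^ k : ℕ+) : ℕ) → r < K k + 1 := fun k r hr => by
    rw [hcast] at hr
    exact hr.trans_lt (Nat.lt_floor_add_one _)
  have hf1 : 0 < f 1 := hfpos 1
  let C : ℝ := max Cg (C₁ + γ * α + 3 / f 1)
  refine ⟨(coloringMachine A P).toLocal, C, fun I hI ports hports => ?_⟩
  set w : Λ → ℕ+ := fun q => q.1 I with hw
  set σ := s (Nat.toPNat' ⌈f w⌉₊) with hσ
  have hσ1 : (1 : ℝ) ≤ σ := by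
    exact_mod_cast one_le_sequenceNumber hs (le_toPNat'_ceil (hfpos w))
  have hf1w : f 1 ≤ f w := hfmono fun _ => one_le
  have hfw := hfpos w
  have hdeg : ∀ {k v}, v ∈ contenders I ports K k → I.degree v ≤ ((2 ^ k : ℕ+) : ℕ) :=
    fun {k v} hv => by
      rw [PNat.pow_coe]
      exact (contender_bounds hports hv).1
  -- the running time for the true parameters, with the maximum degree replaced by its guess
  have hfz : ∀ {k v}, v ∈ contenders I ports K k → f (raise maxDegree (2 ^ k) w) ≤ α * f w :=
    fun {k v} hv => hraiseΔ w _ fun h => (contender_bounds hports hv).2.2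
  refine coloringMachine_colorsWithin hports hpal (T₁ := ⌊C₁ * (f w * σ)⌋₊)
    (T₂ := ⌈γ * (α * f w)⌉₊) ?_ ?_ ?_ ?_
  · rintro k ⟨v, hv⟩
    obtain ⟨n, hn1, hn2, hn3⟩ := hsched w _ (hfz hv)
    refine ⟨n, Nat.le_floor hn3, fun W hW hWc => ?_⟩
    have hsub : (I.restrict W hW).IsSub I := ⟨I.induce_isSub W _ _ _, fun _ _ => rfl⟩
    have hJ := h𝒢 _ hI _ hsub.1
    have hD : maxDegree (I.restrict W hW) ≤ 2 ^ k :=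
      maxDegree_induce_le fun u hu _ => hdeg (hWc hu)
    have hq : ∀ q : Λ, q.1 (I.restrict W hW) ≤ x n q := fun q =>
      (hΛmono q.1 q.2 I _ hI hsub).trans ((le_raise maxDegree _ w q).trans (hn1 q))
    obtain ⟨K', T, h1, h2, h3⟩ := hA.colorsWithin hfmono hgmono hJ
      (isPortNumbering_portsIn hports W _ _ _) (a := P.trialGuess k n) (D := 2 ^ k) (x := x n)
      (fun p => by
        simp only [P]
        split_ifs with h
        · exact h ▸ hD
        · exact hF p _ hJ _ hq)
      hD (fun p h => if_pos h)
      (fun q h => by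
        simp only [P]
        split_ifs with e
        · exact (le_raise_self e).trans (hn1 q)
        · exact (hFΛ ⟨q.1, h⟩ q.2 _).le)
      (fun q _ => hq q)
    exact ⟨K', T, h1, hgK k _ h2, h3.trans hn2⟩
  · rintro k ⟨v, hv⟩ χ hpos hproper hχ
    set W := contenders I ports K k with hW
    have hWI : W ⊆ I.verts := Finset.filter_subset _ _
    have hJ := h𝒢 _ hI _ (I.induce_isSub W χ hpos hproper)
    have hD : maxDegree (I.induce W χ hpos hproper) ≤ 2 ^ k :=
      maxDegree_induce_le fun u hu _ => hdeg hu
    have hM : maxColor (I.induce W χ hpos hproper) ≤ M k := maxColor_le fun u hu => by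
      rw [PNat.pow_coe]
      exact hχ u (Finset.mem_inter.1 hu).2
    set z := raise maxDegree (2 ^ k) w with hz
    have hzy : z ≤ raise maxColor (M k) z := le_raise _ _ _
    obtain ⟨K', T, h1, h2, h3⟩ := hA.colorsWithin hfmono hgmono hJ
      (isPortNumbering_portsIn hports W _ _ _) (a := P.finalGuess k) (D := 2 ^ k)
      (x := raise maxColor (M k) z)
      (fun p => by
        simp only [P]
        split_ifs with h
        · exact h ▸ hD
        · exact ((hΓ p.1 p.2).resolve_left h) ▸ hM)
      hD (fun p h => if_pos h)
      (fun q h => by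
        simp only [P]
        split_ifs with e
        · exact (le_raise_self e).trans (hzy q)
        · exact le_raise_self ((hΓ q.1 h).resolve_left e))
      (fun q _ => by
        rcases hΛ q.1 q.2 with h | h
        · rw [h]
          exact hM.trans (le_raise_self h)
        · exact (h.induce_le h𝒢 (hΛmono q.1 q.2) hI hWI χ hpos hproper).trans
            ((le_raise maxDegree _ w q).trans (hzy q)))
    refine ⟨K', T, h1, hgK k _ h2, h3.trans (le_trans ?_ (Nat.le_ceil _))⟩
    -- the initial colors of the contenders exceed the size of the palette
    have h4 : (K k).succPNat ≤ maxColor I := (contender_bounds hports hv).2.1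
    have h5 : 2 ≤ (K k).succPNat := by
      rw [← PNat.coe_le_coe, Nat.succPNat_coe]
      have := (Nat.one_le_two_pow (n := k)).trans (hpal k)
      exact Nat.succ_le_succ this
    refine (hraisem z _ h5 fun h => h4.trans (le_raise maxDegree _ w ⟨maxColor, h⟩)).trans ?_
    exact mul_le_mul_of_nonneg_left (hfz hv) hγ.le
  · refine (hpalette (maxDegree I)).trans (mul_le_mul_of_nonneg_right (le_max_left _ _) ?_)
    have hpos : (0 : ℝ) < (maxDegree I : ℕ) := Nat.cast_pos.2 (PNat.pos _)
    exact hpos.le.trans (hgQ _ hpos).1.le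
  · have hfσ : f w ≤ f w * σ := le_mul_of_one_le_right hfw.le hσ1
    have h3 : 3 ≤ 3 / f 1 * (f w * σ) := by
      rw [div_mul_eq_mul_div, le_div_iff₀ hf1]
      linarith
    have h4 : γ * (α * f w) ≤ γ * α * (f w * σ) := by
      rw [← mul_assoc]
      gcongr
    have h5 := Nat.ceil_lt_add_one (a := γ * (α * f w)) (by positivity)
    have hC : (C₁ + γ * α + 3 / f 1) * (f w * σ) ≤ C * (f w * σ) :=
      mul_le_mul_of_nonneg_right (le_max_right _ _) (hfw.le.trans hfσ)
    refine le_trans ?_ hC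
    have h6 := Nat.floor_le (a := C₁ * (f w * σ)) (by positivity)
    push_cast
    linarith
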